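/- For $h>0$ put $c=c_h=\sqrt{\tanh h}$ and, for $\varphi\ge 0$, $\Omega(\varphi,h)=\sqrt{\varphi\tanh(h\varphi)}$. For an integer $p\ge 2$ let $\underline\varphi(p,h)$ be the unique $\varphi>0$ with $\omega^-(\varphi,h)=\omega^+(\varphi+p,h)$, where $\omega^\pm(\varphi,h)=c_h\varphi\mp\Omega(\varphi,h)$ (the Floquet exponent at which the water waves operator linearized at the flat surface of depth $h$ has its $p$-th double eigenvalue). For $0\le j\le p$ put $$\Omega_j=\Omega(j+\underline\varphi(p,h),h),\qquad t_j=\sqrt{\frac{j+\underline\varphi(p,h)}{\tanh(h(j+\underline\varphi(p,h)))}}.$$ Let $$p_1=-\frac2c,\quad p_2=-\frac{3+c^4}{2c^7},\quad p_3=-\frac{c^{12}+17c^8+51c^4+27}{32c^{13}},\quad p_4=\frac{-c^{20}-39c^{16}-366c^{12}-850c^8-657c^4-135}{64c^{19}(c^4+5)},$$ $$a_1=-(c^2+c^{-2}),\quad a_2=\frac{9c^8-14c^4-3}{4c^8},\quad a_3=\frac{-c^{16}-98c^{12}+252c^8-318c^4-27}{64c^{14}},$$ $$a_4=\frac{9c^{24}+238c^{20}-233c^{16}-1676c^{12}+743c^8-3042c^4-135}{128c^{20}(c^4+5)}$$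 (the coefficients of $\epsilon^\ell\cos(\ell x)$ in the two periodic functions that appear in the operator linearized at the Stokes wave of amplitude $\epsilon$). For $p=2,3,4$ the coefficient $\beta_1^{(p)}(h)$ governing the $p$-th high-frequency instability isola of Stokes waves of depth $h$ is $$\beta_1^{(p)}(h)=\frac{\sqrt{\Omega_0\Omega_p}}4\sum_{q=0}^{p-1}\ \sum_{0=j_0<j_1<\dots<j_q<j_{q+1}=p}\ \sum_{\sigma_1,\dots,\sigma_q\in\{\pm1\}}\ \prod_{i=1}^{q}\frac{\sigma_i\,\Omega_{j_i}}{4(j_ic_h-\sigma_i\Omega_{j_i}-\Omega_0)}\ \prod_{i=0}^{q}\Big(a_{j_{i+1}-j_i}-p_{j_{i+1}-j_i}\big(\sigma_it_{j_i}+\sigma_{i+1}t_{j_{i+1}}\big)\Big),$$ with $\sigma_0=-1$ and $\sigma_{q+1}=+1$ (a sum of $3^{p-1}$ terms). Theorem. As $h\to+\infty$, $$\beta_1^{(2)}(h)=\frac{3\sqrt3}{64}e^{-h/2}+O(e^{-3h/4}),\qquad \beta_1^{(3)}(h)=\frac{2\sqrt2}{3}e^{-2h}+O(e^{-3h}),\qquad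 \beta_1^{(4)}(h)=-\frac{5\sqrt5}{8\sqrt3}e^{-2h}+O(e^{-4h}).$$ In particular, for $p=2,3,4$, the function $\beta_1^{(p)}$ is not identically zero on $(0,+\infty)$ and has only finitely many zeros $h>0$. -/

import Mathlib

open Filter Asymptotics

namespace StokesIsola

noncomputable section

/-! ## Dispersion relation at depth `h` -/

/-- The linear phase speed `c_h = √(tanh h)`. -/
def waveSpeed (h : ℝ) : ℝ := √(Real.tanh h)

/-- `Ω(φ, h) = √(φ tanh (h φ))`. -/
def Omega (φ h : ℝ) : ℝ := √(φ * Real.tanh (h * φ))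

/-- `ω^σ(φ, h) = c_h φ - σ Ω(φ, h)`, with `σ = 1` or `σ = -1`. The numbers `i ω^σ(j + μ, h)`,
`j ∈ ℤ`, are the eigenvalues of the linearization at the flat surface with Floquet exponent `μ`. -/
def freq (σ φ h : ℝ) : ℝ := waveSpeed h * φ - σ * Omega φ h

/-- The positive Floquet exponents `φ` at which the eigenvalues `i ω^-(φ, h)` and
`i ω^+(φ + p, h)` coincide. -/
def collisionSet (p : ℕ) (h : ℝ) : Set ℝ :=
  {φ : ℝ | 0 < φ ∧ freq (-1) φ h = freq 1 (φ + p) h}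

/-- The wavenumber `φ(p, h)`: the only element of `collisionSet p h` when `2 ≤ p` and `0 < h`
(see `collisionSet_eq_singleton` below). -/
def wavenumber (p : ℕ) (h : ℝ) : ℝ := sInf (collisionSet p h)

/-! ### The collision is unique -/

theorem tanh_pos {x : ℝ} (hx : 0 < x) : 0 < Real.tanh x := by
  rw [Real.tanh_eq_sinh_div_cosh]
  exact div_pos (Real.sinh_pos_iff.2 hx) (Real.cosh_pos x)

theorem tanh_mono : StrictMono Real.tanh := by
  intro x y hxy
  rw [Real.tanh_eq_sinh_div_cosh, Real.tanh_eq_sinh_div_cosh,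
    div_lt_div_iff₀ (Real.cosh_pos x) (Real.cosh_pos y)]
  have h1 : 0 < Real.sinh (y - x) := Real.sinh_pos_iff.2 (sub_pos.2 hxy)
  rw [Real.sinh_sub] at h1
  linarith

theorem tanh_cont : Continuous Real.tanh := by
  have h1 : Real.tanh = fun x => Real.sinh x / Real.cosh x := by
    funext x
    exact Real.tanh_eq_sinh_div_cosh x
  rw [h1]
  exact Real.continuous_sinh.div Real.continuous_cosh fun x => (Real.cosh_pos x).ne'

theorem tanh_add_lt {x y : ℝ} (hx : 0 < x) (hy : 0 < y) :
    Real.tanh (x + y) < Real.tanh x + Real.tanh y := by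
  have h1 := Real.cosh_pos x
  have h2 := Real.cosh_pos y
  have h3 := Real.sinh_pos_iff.2 hx
  have h4 := Real.sinh_pos_iff.2 hy
  rw [Real.tanh_eq_sinh_div_cosh, Real.tanh_eq_sinh_div_cosh, Real.tanh_eq_sinh_div_cosh,
    div_add_div _ _ h1.ne' h2.ne', Real.sinh_add, Real.cosh_add]
  apply div_lt_div_of_pos_left
  · positivity
  · positivity
  · have : 0 < Real.sinh x * Real.sinh y := mul_pos h3 h4
    linarith

theorem tanh_nat_mul_lt {p : ℕ} (hp : 2 ≤ p) {h : ℝ} (hh : 0 < h) :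
    Real.tanh (h * p) < p * Real.tanh h := by
  induction p, hp using Nat.le_induction with
  | base =>
    have h1 := tanh_add_lt hh hh
    have h2 : h * ((2 : ℕ) : ℝ) = h + h := by
      push_cast
      ring
    rw [h2]
    push_cast
    linarith
  | succ n hn ih =>
    have hn0 : (0 : ℝ) < n := by
      have : 0 < n := by omega
      exact_mod_cast this
    have h1 := tanh_add_lt (mul_pos hh hn0) hh
    have h2 : h * ((n + 1 : ℕ) : ℝ) = h * n + h := by
      push_cast
      ring
    rw [h2]
    push_cast
    linarith

theorem mul_tanh_lt {h x y : ℝ} (hh : 0 < h) (hx : 0 ≤ x) (hxy : x < y) :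
    x * Real.tanh (h * x) < y * Real.tanh (h * y) := by
  have hy : 0 < y := lt_of_le_of_lt hx hxy
  have h1 : Real.tanh (h * x) < Real.tanh (h * y) := tanh_mono (mul_lt_mul_of_pos_left hxy hh)
  have h2 := tanh_pos (mul_pos hh hy)
  nlinarith

theorem Omega_lt {h x y : ℝ} (hh : 0 < h) (hx : 0 ≤ x) (hxy : x < y) : Omega x h < Omega y h := by
  have h1 : 0 ≤ x * Real.tanh (h * x) :=
    mul_nonneg hx (by simpa using tanh_mono.monotone (mul_nonneg hh.le hx))
  exact Real.sqrt_lt_sqrt h1 (mul_tanh_lt hh hx hxy)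

theorem Omega_cont (h : ℝ) : Continuous fun x => Omega x h := by
  unfold Omega
  exact (continuous_id.mul (tanh_cont.comp (continuous_const.mul continuous_id))).sqrt

theorem mem_collisionSet {p : ℕ} {h φ : ℝ} :
    φ ∈ collisionSet p h ↔ 0 < φ ∧ Omega φ h + Omega (φ + p) h = p * waveSpeed h := by
  unfold collisionSet freq
  constructor
  · rintro ⟨h1, h2⟩
    exact ⟨h1, by linarith⟩
  · rintro ⟨h1, h2⟩
    exact ⟨h1, by linarith⟩

theorem existsUnique_collision {p : ℕ} (hp : 2 ≤ p) {h : ℝ} (hh : 0 < h) :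
    ∃! φ : ℝ, φ ∈ collisionSet p h := by
  have hp2 : (2 : ℝ) ≤ p := by exact_mod_cast hp
  have ht := tanh_pos hh
  let f : ℝ → ℝ := fun x => Omega x h + Omega (x + p) h
  have hf : Continuous f := (Omega_cont h).add ((Omega_cont h).comp (continuous_id.add
    continuous_const))
  have hsq : (p : ℝ) * waveSpeed h = √((p : ℝ) ^ 2 * Real.tanh h) := by
    rw [Real.sqrt_mul (by positivity), Real.sqrt_sq (by positivity), waveSpeed]
  have h0 : f 0 < p * waveSpeed h := by
    have h1 : f 0 = √((p : ℝ) * Real.tanh (h * p)) := by simp [f, Omega]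
    rw [h1, hsq]
    apply Real.sqrt_lt_sqrt
    · exact mul_nonneg (by positivity) (tanh_pos (by positivity)).le
    · have := tanh_nat_mul_lt hp hh
      nlinarith
  have h1 : p * waveSpeed h ≤ f ((p : ℝ) ^ 2) := by
    have h2 : √((p : ℝ) ^ 2 * Real.tanh h) ≤ Omega ((p : ℝ) ^ 2 + p) h := by
      apply Real.sqrt_le_sqrt
      have h3 : Real.tanh h ≤ Real.tanh (h * ((p : ℝ) ^ 2 + p)) := by
        apply tanh_mono.monotone
        nlinarith [sq_nonneg (p : ℝ)]
      have h4 : (p : ℝ) ^ 2 ≤ (p : ℝ) ^ 2 + p := by linarith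
      exact mul_le_mul h4 h3 ht.le (by positivity)
    have h5 : 0 ≤ Omega ((p : ℝ) ^ 2) h := Real.sqrt_nonneg _
    rw [hsq]
    show _ ≤ Omega ((p : ℝ) ^ 2) h + Omega ((p : ℝ) ^ 2 + p) h
    linarith
  obtain ⟨φ, ⟨hφ0, -⟩, hφ⟩ := intermediate_value_Icc (sq_nonneg (p : ℝ)) hf.continuousOn
    ⟨h0.le, h1⟩
  have hφpos : 0 < φ := by
    rcases hφ0.eq_or_lt with h2 | h2
    · rw [← h2] at hφ
      linarith
    · exact h2
  have hmono : ∀ x y : ℝ, 0 ≤ x → x < y → f x < f y := fun x y hx hxy =>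
    add_lt_add (Omega_lt hh hx hxy) (Omega_lt hh (by positivity) (by linarith))
  refine ⟨φ, mem_collisionSet.2 ⟨hφpos, hφ⟩, fun ψ hψ => ?_⟩
  obtain ⟨hψ0, hψ1⟩ := mem_collisionSet.1 hψ
  have hψ2 : f ψ = f φ := by
    rw [hφ]
    exact hψ1
  rcases lt_trichotomy ψ φ with h2 | h2 | h2
  · exact absurd hψ2 (hmono ψ φ hψ0.le h2).ne
  · exact h2
  · exact absurd hψ2 (hmono φ ψ hφpos.le h2).ne'

theorem collisionSet_eq_singleton {p : ℕ} (hp : 2 ≤ p) {h : ℝ} (hh : 0 < h) :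
    collisionSet p h = {wavenumber p h} := by
  obtain ⟨φ, hφ, hu⟩ := existsUnique_collision hp hh
  have h1 : collisionSet p h = {φ} := Set.eq_singleton_iff_unique_mem.2 ⟨hφ, hu⟩
  rw [wavenumber, h1, csInf_singleton]

/-! ## Taylor-Fourier coefficients of the linearized operator -/

/-- The coefficient `a_ℓ^[ℓ]` of `ε^ℓ cos (ℓ x)` in the function `a_ε`, for `ℓ = 1, 2, 3, 4`
(the other values of `ℓ` are not used). -/
def aCoeff (ℓ : ℕ) (h : ℝ) : ℝ :=
  let c := waveSpeed h
  match ℓ with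
  | 1 => -(c ^ 2 + (c ^ 2)⁻¹)
  | 2 => (-14 * c ^ 4 + 9 * c ^ 8 - 3) / (4 * c ^ 8)
  | 3 => (-c ^ 16 - 98 * c ^ 12 + 252 * c ^ 8 - 318 * c ^ 4 - 27) / (64 * c ^ 14)
  | 4 => (9 * c ^ 24 + 238 * c ^ 20 - 233 * c ^ 16 - 1676 * c ^ 12 + 743 * c ^ 8 - 3042 * c ^ 4
      - 135) / (128 * c ^ 20 * (c ^ 4 + 5))
  | _ => 0

/-- The coefficient `p_ℓ^[ℓ]` of `ε^ℓ cos (ℓ x)` in the function `p_ε`, for `ℓ = 1, 2, 3, 4`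
(the other values of `ℓ` are not used). -/
def pCoeff (ℓ : ℕ) (h : ℝ) : ℝ :=
  let c := waveSpeed h
  match ℓ with
  | 1 => -2 * c⁻¹
  | 2 => -((3 + c ^ 4) / (2 * c ^ 7))
  | 3 => -((c ^ 12 + 17 * c ^ 8 + 51 * c ^ 4 + 27) / (32 * c ^ 13))
  | 4 => (-c ^ 20 - 39 * c ^ 16 - 366 * c ^ 12 - 850 * c ^ 8 - 657 * c ^ 4 - 135) /
      (64 * c ^ 19 * (c ^ 4 + 5))
  | _ => 0

/-! ## The coefficients `β₁^(p)` -/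

/-- `Ω_j^(p) = Ω(j + φ(p, h), h)`. -/
def Om (p : ℕ) (h : ℝ) (j : ℕ) : ℝ := Omega (j + wavenumber p h) h

/-- `t_j^(p) = √((j + φ(p, h)) / tanh (h (j + φ(p, h))))`. -/
def tt (p : ℕ) (h : ℝ) (j : ℕ) : ℝ :=
  √((j + wavenumber p h) / Real.tanh (h * (j + wavenumber p h)))

/-- The coupling `a_ℓ^[ℓ] - p_ℓ^[ℓ] (σ t_i + τ t_j)`, `ℓ = j - i`, between the harmonic `i` with
sign `σ` and the harmonic `j > i` with sign `τ`. -/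
def coupling (p : ℕ) (h : ℝ) (i : ℕ) (σ : ℝ) (j : ℕ) (τ : ℝ) : ℝ :=
  aCoeff (j - i) h - pCoeff (j - i) h * (σ * tt p h i + τ * tt p h j)

/-- The factor `Ω_j / (4 (j c_h - σ Ω_j - Ω_0))` of an intermediate harmonic `j` with sign `σ`. -/
def propagator (p : ℕ) (h : ℝ) (j : ℕ) (σ : ℝ) : ℝ :=
  Om p h j / (4 * (j * waveSpeed h - σ * Om p h j - Om p h 0))

/-- The common factor `√(Ω_0 Ω_p) / 4`. -/
def amplitude (p : ℕ) (h : ℝ) : ℝ := 1 / 4 * √(Om p h 0 * Om p h p)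

/-- No intermediate harmonic: the harmonic `0` with sign `-` is coupled to `p` with sign `+`. -/
def b0 (p : ℕ) (h : ℝ) : ℝ := amplitude p h * coupling p h 0 (-1) p 1

/-- The term with one intermediate harmonic `j`. -/
def b1 (p : ℕ) (h : ℝ) (j : ℕ) (σ : ℝ) : ℝ :=
  amplitude p h * propagator p h j σ * (coupling p h 0 (-1) j σ * coupling p h j σ p 1)

/-- The term with two intermediate harmonics `j < k`. -/
def b2 (p : ℕ) (h : ℝ) (j k : ℕ) (σ τ : ℝ) : ℝ :=
  amplitude p h * (propagator p h j σ * propagator p h k τ) *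
    (coupling p h 0 (-1) j σ * coupling p h j σ k τ * coupling p h k τ p 1)

/-- The term with three intermediate harmonics `j < k < l`. -/
def b3 (p : ℕ) (h : ℝ) (j k l : ℕ) (σ τ υ : ℝ) : ℝ :=
  amplitude p h * (propagator p h j σ * propagator p h k τ * propagator p h l υ) *
    (coupling p h 0 (-1) j σ * coupling p h j σ k τ * coupling p h k τ l υ * coupling p h l υ p 1)

/-- Signed sum over `σ = +` and `σ = -` of the terms with intermediate harmonic `j`. -/
def B1 (p : ℕ) (h : ℝ) (j : ℕ) : ℝ := b1 p h j 1 - b1 p h j (-1)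

/-- Signed sum of the four terms with intermediate harmonics `j < k`. -/
def B2 (p : ℕ) (h : ℝ) (j k : ℕ) : ℝ :=
  b2 p h j k 1 1 - b2 p h j k (-1) 1 + b2 p h j k (-1) (-1) - b2 p h j k 1 (-1)

/-- Signed sum of the eight terms with intermediate harmonics `j < k < l`. -/
def B3 (p : ℕ) (h : ℝ) (j k l : ℕ) : ℝ :=
  b3 p h j k l (-1) 1 (-1) - b3 p h j k l (-1) (-1) (-1) + b3 p h j k l 1 (-1) (-1)
    - b3 p h j k l 1 1 (-1) + b3 p h j k l 1 1 1 - b3 p h j k l 1 (-1) 1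
    + b3 p h j k l (-1) (-1) 1 - b3 p h j k l (-1) 1 1

/-- `β₁^(2)(h)`. -/
def betaTwo (h : ℝ) : ℝ := b0 2 h + B1 2 h 1

/-- `β₁^(3)(h)`. -/
def betaThree (h : ℝ) : ℝ := b0 3 h + B1 3 h 1 + B1 3 h 2 + B2 3 h 1 2

/-- `β₁^(4)(h)`. -/
def betaFour (h : ℝ) : ℝ :=
  b0 4 h + B1 4 h 1 + B1 4 h 2 + B1 4 h 3 + B2 4 h 1 2 + B2 4 h 1 3 + B2 4 h 2 3 + B3 4 h 1 2 3

end

end StokesIsola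

/-!
Divided by the positive amplitude, `β₁^(p)` is a sum over chains of harmonics from `0` to `p`, in
which every intermediate harmonic `j` carries a sign `σ`. As a function of the sign and of `t_j`, a
coupling is affine in `σ t_j`, so the sum over the sign of an intermediate harmonic only involves
three moments of the propagators (`moment0`, `moment1`, `moment2`), and the chain sum is computed by
a recursion along the harmonics (`betaTwo_eq`, `betaThree_eq`, `betaFour_eq`). Since
`Ω_j² = (j + φ) tanh (h (j + φ))` and `Ω_j t_j = j + φ`, the moments are rational in `c_h`, `Ω_0`,
`φ` and the hyperbolic tangents (`moments_eq`): the irrational frequencies `Ω_j`, `0 < j < p`,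
disappear.

*Deep water.* The collision condition gives `Ω_0` as a rational expression in `c_h` with corrections
proportional to the deviations of `tanh (h φ)` and `tanh (h (p + φ))` from `1` (`Om_zero_eq`), and
the bound `√φ ≥ (p c_h - 1 / c_h) / 2` makes these deviations at most of size `e^{-2hφ}`, with `φ`
replaced by its limit `((p - 1) / 2)²` (`isBigO_exp_wavenumber`, `firstOrder_tanhAt_zero`).
Everything is then expanded to first order, `f = a + b x + O(e)` (`FirstOrder`), with `x = e^{-h/2}`
for `p = 2` and `x = e^{-2h}` for `p = 3, 4`. The chain sum vanishes at order zero, and its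
coefficient of `x` is `3/8`, `8/3`, `-5/3` for `p = 2, 3, 4`.

*Finitely many zeros.* In terms of `s = √h`, the quantities `c_h`, `Ω_j`, `t_j` are meromorphic on
the closed half-line `[0, ∞)`: dividing the collision condition by `√h` makes it analytic and
nondegenerate at `h = 0` as well, and the implicit function theorem applies
(`analyticAt_wavenumber_sq`). The chain sum is therefore meromorphic in `s` up to the shallow-water
limit. The expansions show that it has no zeros for large `h`, so by the identity principle its
zeros are isolated, and they lie in a compact interval (`IsRootMeromorphic.finite_zeros`).
-/

/-! ### First-order expansions at infinity -/

namespace StokesIsola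

/-- `FirstOrder x e f a b` says that `f = a + b x + O(e)` at infinity. -/
def FirstOrder (x e f : ℝ → ℝ) (a b : ℝ) : Prop :=
  (fun h => f h - (a + b * x h)) =O[atTop] e

/-- The conditions on a small quantity `x` and an error `e` under which the expansions
`a + b x + O(e)` are closed under field operations: `x² = O(e)` and `e = O(x)`. -/
structure IsScale (x e : ℝ → ℝ) : Prop where
  tendsto : Tendsto x atTop (nhds 0)
  sq : (fun h => x h * x h) =O[atTop] e
  err : e =O[atTop] x

section calculus

variable {x e f g : ℝ → ℝ} {a b a' b' : ℝ}

theorem IsScale.self (hs : IsScale x e) : IsScale x x :=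
  ⟨hs.tendsto, hs.sq.trans hs.err, isBigO_refl _ _⟩

theorem IsScale.isBigO_one (hs : IsScale x e) : x =O[atTop] (fun _ => (1 : ℝ)) :=
  hs.tendsto.isBigO_one ℝ

theorem FirstOrder.of_eq (hf : FirstOrder x e f a b) (ha : a = a') (hb : b = b') :
    FirstOrder x e f a' b' := by
  subst ha hb
  exact hf

theorem FirstOrder.congr' (hf : FirstOrder x e f a b) (h : ∀ᶠ t in atTop, f t = g t) :
    FirstOrder x e g a b := by
  refine IsBigO.congr' hf ?_ EventuallyEq.rfl
  filter_upwards [h] with t ht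
  rw [ht]

theorem FirstOrder.const (a : ℝ) : FirstOrder x e (fun _ => a) a 0 := by
  simp only [FirstOrder, zero_mul, add_zero, sub_self]
  exact isBigO_zero _ _

theorem FirstOrder.add (hf : FirstOrder x e f a b) (hg : FirstOrder x e g a' b') :
    FirstOrder x e (fun h => f h + g h) (a + a') (b + b') :=
  (IsBigO.add hf hg).congr_left fun h => by ring

theorem FirstOrder.sub (hf : FirstOrder x e f a b) (hg : FirstOrder x e g a' b') :
    FirstOrder x e (fun h => f h - g h) (a - a') (b - b') :=
  (IsBigO.sub hf hg).congr_left fun h => by ring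

theorem FirstOrder.neg (hf : FirstOrder x e f a b) : FirstOrder x e (fun h => -f h) (-a) (-b) :=
  (IsBigO.neg_left hf).congr_left fun h => by ring

theorem FirstOrder.weaken (hs : IsScale x e) (hf : FirstOrder x e f a b) :
    FirstOrder x x f a 0 := by
  have h1 := (IsBigO.trans hf hs.err).add ((isBigO_refl x atTop).const_mul_left b)
  exact h1.congr_left fun h => by ring

theorem FirstOrder.tendsto (hs : IsScale x e) (hf : FirstOrder x e f a b) :
    Tendsto f atTop (nhds a) := by
  have h1 : (fun h => f h - a) =O[atTop] x := by
    simpa [FirstOrder] using hf.weaken hs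
  have h2 := (h1.trans_tendsto hs.tendsto).add_const a
  simpa using h2

theorem FirstOrder.bounded (hs : IsScale x e) (hf : FirstOrder x e f a b) :
    f =O[atTop] (fun _ => (1 : ℝ)) :=
  (hf.tendsto hs).isBigO_one ℝ

/-- A factor known to leading order only is enough next to a small factor. -/
theorem FirstOrder.mul_small (hs : IsScale x e) (hg : FirstOrder x e g 0 b)
    (hf : FirstOrder x x f a b') : FirstOrder x e (fun h => g h * f h) 0 (b * a) := by
  have h1 : (fun h => (g h - (0 + b * x h)) * f h) =O[atTop] fun h => e h * 1 :=
    IsBigO.mul hg (hf.bounded hs.self)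
  have h2 : (fun h => f h - (a + 0 * x h)) =O[atTop] x := hf.weaken hs.self
  have h3 := ((isBigO_refl x atTop).mul h2).trans hs.sq
  have h4 := (h1.congr_right (g₂ := e) fun h => by ring).add (h3.const_mul_left b)
  exact h4.congr_left fun h => by ring

theorem FirstOrder.mul_bounded (hg : FirstOrder x e g 0 0)
    (hf : f =O[atTop] (fun _ => (1 : ℝ))) : FirstOrder x e (fun h => g h * f h) 0 0 := by
  have h1 : (fun h => (g h - (0 + 0 * x h)) * f h) =O[atTop] fun h => e h * 1 := IsBigO.mul hg hf
  exact (h1.congr_right (g₂ := e) fun h => by ring).congr_left fun h => by ring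

theorem FirstOrder.mul (hs : IsScale x e) (hf : FirstOrder x e f a b)
    (hg : FirstOrder x e g a' b') :
    FirstOrder x e (fun h => f h * g h) (a * a') (a * b' + b * a') := by
  have h1 : FirstOrder x e (fun h => f h - a) 0 b := (hf.sub (.const a)).of_eq (by ring) (by ring)
  have h2 := h1.mul_small hs (hg.weaken hs)
  have h3 : FirstOrder x e (fun h => a * g h) (a * a') (a * b') :=
    (IsBigO.const_mul_left hg a).congr_left fun h => by ring
  have h4 := h2.add h3
  refine (h4.congr' (Eventually.of_forall fun h => ?_)).of_eq (by ring) (by ring)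
  ring

theorem FirstOrder.pow (hs : IsScale x e) (hf : FirstOrder x e f a b) (n : ℕ) :
    FirstOrder x e (fun h => f h ^ n) (a ^ n) (n * a ^ (n - 1) * b) := by
  induction n with
  | zero => simpa using FirstOrder.const (x := x) (e := e) 1
  | succ n ih =>
    have h1 := (ih.mul hs hf).congr' (Eventually.of_forall fun h => (pow_succ (f h) n).symm)
    refine h1.of_eq (pow_succ a n).symm ?_
    rcases n with _ | n
    · simp
    · simp only [Nat.add_sub_cancel]
      push_cast
      ring

theorem isBigO_inv_of_tendsto (hf : Tendsto f atTop (nhds a)) (ha : a ≠ 0) :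
    (fun h => (f h)⁻¹) =O[atTop] (fun _ => (1 : ℝ)) :=
  (hf.inv₀ ha).isBigO_one ℝ

theorem FirstOrder.inv (hs : IsScale x e) (hf : FirstOrder x e f a b) (ha : a ≠ 0) :
    FirstOrder x e (fun h => (f h)⁻¹) a⁻¹ (-b / a ^ 2) := by
  have ht := hf.tendsto hs
  -- `f * (1 / a - b x / a²) = 1 + O(e)`, and dividing by `f` keeps the error.
  have hx : FirstOrder x e x 0 1 := by
    simp only [FirstOrder, zero_add, one_mul, sub_self]
    exact isBigO_zero _ _
  have h1 := hf.mul hs ((FirstOrder.const a⁻¹).add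
    ((FirstOrder.const (x := x) (e := e) (-b / a ^ 2)).mul hs hx))
  have h2 : FirstOrder x e
      (fun h => f h * (a⁻¹ + -b / a ^ 2 * x h) - 1) 0 0 := by
    refine (h1.sub (.const 1)).of_eq ?_ ?_ <;> field_simp <;> ring
  have h3 := h2.mul_bounded (isBigO_inv_of_tendsto ht ha)
  have h4 : (fun h => -((f h * (a⁻¹ + -b / a ^ 2 * x h) - 1) * (f h)⁻¹ - (0 + 0 * x h)))
      =O[atTop] e := IsBigO.neg_left h3
  refine IsBigO.congr' h4 ?_ EventuallyEq.rfl
  filter_upwards [ht.eventually_ne ha] with h hh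
  field_simp
  ring

theorem FirstOrder.div (hs : IsScale x e) (hf : FirstOrder x e f a b)
    (hg : FirstOrder x e g a' b') (ha : a' ≠ 0) :
    FirstOrder x e (fun h => f h / g h) (a / a') ((b * a' - a * b') / a' ^ 2) := by
  refine ((hf.mul hs (hg.inv hs ha)).congr' (Eventually.of_forall fun h => ?_)).of_eq ?_ ?_
  · rw [div_eq_mul_inv]
  · rw [div_eq_mul_inv]
  · field_simp
    ring

theorem FirstOrder.sqrt (hs : IsScale x e) (hf : FirstOrder x e f a b) (ha : 0 < a) :
    FirstOrder x e (fun h => √(f h)) √a (b / (2 * √a)) := by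
  have hr : √a ≠ 0 := (Real.sqrt_pos.2 ha).ne'
  have hx : FirstOrder x e x 0 1 := by
    simp only [FirstOrder, zero_add, one_mul, sub_self]
    exact isBigO_zero _ _
  have ht := hf.tendsto hs
  -- The candidate `q` satisfies `q² = f + O(e)`; divide by `√f + q`.
  have hq : FirstOrder x e (fun h => √a + b / (2 * √a) * x h) √a (b / (2 * √a)) :=
    ((FirstOrder.const √a).add
      ((FirstOrder.const (x := x) (e := e) (b / (2 * √a))).mul hs hx)).of_eq (by ring) (by ring)
  have h1 : FirstOrder x e (fun h => f h -
      (√a + b / (2 * √a) * x h) * (√a + b / (2 * √a) * x h)) 0 0 := by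
    refine (hf.sub (hq.mul hs hq)).of_eq ?_ ?_
    · rw [Real.mul_self_sqrt ha.le, sub_self]
    · field_simp
      ring
  have h2 : Tendsto (fun h => √(f h) + (√a + b / (2 * √a) * x h)) atTop (nhds (√a + √a)) :=
    ht.sqrt.add (hq.tendsto hs)
  have h3 : √a + √a ≠ 0 := by
    have := Real.sqrt_pos.2 ha
    positivity
  have h4 := h1.mul_bounded (isBigO_inv_of_tendsto h2 h3)
  refine IsBigO.congr' h4 ?_ EventuallyEq.rfl
  filter_upwards [h2.eventually_ne h3, ht.eventually_const_lt ha] with h hh hpos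
  have h5 : f h = √(f h) * √(f h) := (Real.mul_self_sqrt hpos.le).symm
  have h6 : f h - (√a + b / (2 * √a) * x h) * (√a + b / (2 * √a) * x h) =
      (√(f h) - (√a + b / (2 * √a) * x h)) * (√(f h) + (√a + b / (2 * √a) * x h)) := by
    linear_combination h5
  rw [h6, mul_assoc, mul_inv_cancel₀ hh]
  ring

end calculus

end StokesIsola

/-! ### Chain sums by recursion along the harmonics -/

namespace StokesIsola
noncomputable section

/-- Sum over the sign `σ` of the signed propagators of the harmonic `j`. -/
def moment0 (p : ℕ) (h : ℝ) (j : ℕ) : ℝ := propagator p h j 1 - propagator p h j (-1)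

/-- Sum over the sign `σ` of the signed propagators of the harmonic `j`, weighted by `σ t_j`. -/
def moment1 (p : ℕ) (h : ℝ) (j : ℕ) : ℝ :=
  (propagator p h j 1 + propagator p h j (-1)) * tt p h j

/-- Sum over the sign `σ` of the signed propagators of the harmonic `j`, weighted by `t_j²`. -/
def moment2 (p : ℕ) (h : ℝ) (j : ℕ) : ℝ :=
  (propagator p h j 1 - propagator p h j (-1)) * tt p h j ^ 2

/-- The sum over all chains from the harmonic `0` to the harmonic `j` with sign `σ` has the form
`A + B σ t_j`. Given `A` and `B`, this is the coefficient of `a_ℓ` when the chain is prolonged from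
`j` to `j + ℓ`. -/
def passU (p : ℕ) (h : ℝ) (j : ℕ) (A B : ℝ) : ℝ := moment0 p h j * A + moment1 p h j * B

/-- The coefficient of `-p_ℓ` when a chain sum `A + B σ t_j` is prolonged from `j` to `j + ℓ`,
see `passU`. -/
def passW (p : ℕ) (h : ℝ) (j : ℕ) (A B : ℝ) : ℝ := moment1 p h j * A + moment2 p h j * B

/-- The coefficient `A` of the chain sum `A + B σ t_1` at the harmonic `1`. -/
def chainA1 (p : ℕ) (h : ℝ) : ℝ := aCoeff 1 h + pCoeff 1 h * tt p h 0

/-- The coefficient `B` of the chain sum `A + B σ t_1` at the harmonic `1`. -/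
def chainB1 (h : ℝ) : ℝ := -pCoeff 1 h

/-- `passU` at the harmonic `1`. -/
def chainU1 (p : ℕ) (h : ℝ) : ℝ := passU p h 1 (chainA1 p h) (chainB1 h)

/-- `passW` at the harmonic `1`. -/
def chainW1 (p : ℕ) (h : ℝ) : ℝ := passW p h 1 (chainA1 p h) (chainB1 h)

/-- The coefficient `A` of the chain sum at the harmonic `2`. -/
def chainA2 (p : ℕ) (h : ℝ) : ℝ :=
  aCoeff 2 h + pCoeff 2 h * tt p h 0 + (chainU1 p h * aCoeff 1 h - chainW1 p h * pCoeff 1 h)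

/-- The coefficient `B` of the chain sum at the harmonic `2`. -/
def chainB2 (p : ℕ) (h : ℝ) : ℝ := -pCoeff 2 h - chainU1 p h * pCoeff 1 h

/-- `passU` at the harmonic `2`. -/
def chainU2 (p : ℕ) (h : ℝ) : ℝ := passU p h 2 (chainA2 p h) (chainB2 p h)

/-- `passW` at the harmonic `2`. -/
def chainW2 (p : ℕ) (h : ℝ) : ℝ := passW p h 2 (chainA2 p h) (chainB2 p h)

/-- The coefficient `A` of the chain sum at the harmonic `3`. -/
def chainA3 (p : ℕ) (h : ℝ) : ℝ :=
  aCoeff 3 h + pCoeff 3 h * tt p h 0 + (chainU1 p h * aCoeff 2 h - chainW1 p h * pCoeff 2 h) +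
    (chainU2 p h * aCoeff 1 h - chainW2 p h * pCoeff 1 h)

/-- The coefficient `B` of the chain sum at the harmonic `3`. -/
def chainB3 (p : ℕ) (h : ℝ) : ℝ :=
  -pCoeff 3 h - chainU1 p h * pCoeff 2 h - chainU2 p h * pCoeff 1 h

/-- `passU` at the harmonic `3`. -/
def chainU3 (p : ℕ) (h : ℝ) : ℝ := passU p h 3 (chainA3 p h) (chainB3 p h)

/-- `passW` at the harmonic `3`. -/
def chainW3 (p : ℕ) (h : ℝ) : ℝ := passW p h 3 (chainA3 p h) (chainB3 p h)

/-- The coefficient `A` of the chain sum at the harmonic `4`. -/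
def chainA4 (p : ℕ) (h : ℝ) : ℝ :=
  aCoeff 4 h + pCoeff 4 h * tt p h 0 + (chainU1 p h * aCoeff 3 h - chainW1 p h * pCoeff 3 h) +
    (chainU2 p h * aCoeff 2 h - chainW2 p h * pCoeff 2 h) +
    (chainU3 p h * aCoeff 1 h - chainW3 p h * pCoeff 1 h)

/-- The coefficient `B` of the chain sum at the harmonic `4`. -/
def chainB4 (p : ℕ) (h : ℝ) : ℝ :=
  -pCoeff 4 h - chainU1 p h * pCoeff 3 h - chainU2 p h * pCoeff 2 h - chainU3 p h * pCoeff 1 h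

theorem betaTwo_eq (h : ℝ) :
    betaTwo h = amplitude 2 h * (chainA2 2 h + chainB2 2 h * tt 2 h 2) := by
  simp only [betaTwo, b0, B1, b1, coupling, chainA2, chainB2, chainU1, chainW1, passU, passW,
    chainA1, chainB1, moment0, moment1, moment2, Nat.sub_zero, Nat.reduceSub]
  ring

theorem betaThree_eq (h : ℝ) :
    betaThree h = amplitude 3 h * (chainA3 3 h + chainB3 3 h * tt 3 h 3) := by
  simp only [betaThree, b0, B1, b1, B2, b2, coupling, chainA3, chainB3, chainU2, chainW2, chainA2,
    chainB2, chainU1, chainW1, passU, passW, chainA1, chainB1, moment0, moment1, moment2,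
    Nat.sub_zero, Nat.reduceSub]
  ring

set_option maxHeartbeats 800000 in
theorem betaFour_eq (h : ℝ) :
    betaFour h = amplitude 4 h * (chainA4 4 h + chainB4 4 h * tt 4 h 4) := by
  simp only [betaFour, b0, B1, b1, B2, b2, B3, b3, coupling, chainA4, chainB4, chainU3, chainW3,
    chainA3, chainB3, chainU2, chainW2, chainA2,
    chainB2, chainU1, chainW1, passU, passW, chainA1, chainB1, moment0, moment1, moment2,
    Nat.sub_zero, Nat.reduceSub]
  generalize amplitude 4 h = α
  generalize tt 4 h 0 = t0
  generalize tt 4 h 1 = t1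
  generalize tt 4 h 2 = t2
  generalize tt 4 h 3 = t3
  generalize tt 4 h 4 = t4
  generalize propagator 4 h 1 1 = g1
  generalize propagator 4 h 1 (-1) = g1'
  generalize propagator 4 h 2 1 = g2
  generalize propagator 4 h 2 (-1) = g2'
  generalize propagator 4 h 3 1 = g3
  generalize propagator 4 h 3 (-1) = g3'
  ring

end
end StokesIsola

/-! ### The collision and the moments of the propagators -/

namespace StokesIsola
noncomputable section

/-- `tanh (h (j + φ(p, h)))`. -/
def tanhAt (p : ℕ) (h : ℝ) (j : ℕ) : ℝ := Real.tanh (h * (j + wavenumber p h))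

section collision

variable {p : ℕ} {h : ℝ}

theorem wavenumber_mem (hp : 2 ≤ p) (hh : 0 < h) : wavenumber p h ∈ collisionSet p h := by
  rw [collisionSet_eq_singleton hp hh]
  exact Set.mem_singleton _

theorem wavenumber_pos (hp : 2 ≤ p) (hh : 0 < h) : 0 < wavenumber p h :=
  (wavenumber_mem hp hh).1

theorem tanhAt_pos (hp : 2 ≤ p) (hh : 0 < h) (j : ℕ) : 0 < tanhAt p h j :=
  tanh_pos (mul_pos hh (add_pos_of_nonneg_of_pos j.cast_nonneg (wavenumber_pos hp hh)))

theorem Om_pos (hp : 2 ≤ p) (hh : 0 < h) (j : ℕ) : 0 < Om p h j :=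
  Real.sqrt_pos.2 (mul_pos (add_pos_of_nonneg_of_pos j.cast_nonneg (wavenumber_pos hp hh))
    (tanhAt_pos hp hh j))

theorem waveSpeed_pos (hh : 0 < h) : 0 < waveSpeed h := Real.sqrt_pos.2 (tanh_pos hh)

theorem waveSpeed_le_one (h : ℝ) : waveSpeed h ≤ 1 :=
  Real.sqrt_le_one.2 (Real.tanh_lt_one h).le

theorem Om_sq (hp : 2 ≤ p) (hh : 0 < h) (j : ℕ) :
    Om p h j ^ 2 = (j + wavenumber p h) * tanhAt p h j :=
  Real.sq_sqrt (mul_pos (add_pos_of_nonneg_of_pos j.cast_nonneg (wavenumber_pos hp hh))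
    (tanhAt_pos hp hh j)).le

theorem tt_eq (hp : 2 ≤ p) (hh : 0 < h) (j : ℕ) : tt p h j = Om p h j / tanhAt p h j := by
  have h1 := tanhAt_pos hp hh j
  have h2 := Om_sq hp hh j
  have h3 : (j + wavenumber p h) / Real.tanh (h * (j + wavenumber p h)) =
      (Om p h j / tanhAt p h j) ^ 2 := by
    rw [div_pow, h2]
    change _ / tanhAt p h j = _
    field_simp
  rw [tt, h3, Real.sqrt_sq (div_pos (Om_pos hp hh j) h1).le]

theorem Om_add (hp : 2 ≤ p) (hh : 0 < h) : Om p h 0 + Om p h p = p * waveSpeed h := by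
  have h1 := (mem_collisionSet.1 (wavenumber_mem hp hh)).2
  rw [Om, Om, Nat.cast_zero, zero_add, add_comm (p : ℝ) (wavenumber p h)]
  exact h1

/-- The collision condition solved for `Ω_0`, the deviations of the hyperbolic tangents from `1`
being kept on the right-hand side. -/
theorem Om_zero_eq (hp : 2 ≤ p) (hh : 0 < h) :
    Om p h 0 = ((p : ℝ) ^ 2 * waveSpeed h ^ 2 - p +
      (1 - 1 / tanhAt p h 0) * Om p h 0 ^ 2 -
      (1 - 1 / tanhAt p h p) * (p * waveSpeed h - Om p h 0) ^ 2) / (2 * p * waveSpeed h) := by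
  have hp0 : (0 : ℝ) < p := by exact_mod_cast (by omega : 0 < p)
  have hc := waveSpeed_pos hh
  have h0 := tanhAt_pos hp hh 0
  have h1 := tanhAt_pos hp hh p
  have e0 := Om_sq hp hh 0
  have e1 := Om_sq hp hh p
  have e2 : Om p h p = p * waveSpeed h - Om p h 0 := by linarith [Om_add hp hh]
  rw [e2] at e1
  have e3 : 1 / tanhAt p h 0 * Om p h 0 ^ 2 = wavenumber p h := by
    rw [e0]
    field_simp
    simp
  have e4 : 1 / tanhAt p h p * (p * waveSpeed h - Om p h 0) ^ 2 = p + wavenumber p h := by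
    rw [e1]
    field_simp
  rw [eq_div_iff (by positivity), sub_mul, sub_mul, e3, e4]
  ring

theorem wavenumber_eq (hp : 2 ≤ p) (hh : 0 < h) :
    wavenumber p h = Om p h 0 ^ 2 / tanhAt p h 0 := by
  have h0 := tanhAt_pos hp hh 0
  rw [Om_sq hp hh 0]
  field_simp
  simp

/-- Replacing the hyperbolic tangents by `1` increases the frequencies, so the collision occurs not
before that of the deep-water dispersion relation with speed `c_h`. -/
theorem le_sqrt_wavenumber (hp : 2 ≤ p) (hh : 0 < h) :
    (p * waveSpeed h - 1 / waveSpeed h) / 2 ≤ √(wavenumber p h) := by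
  have hp0 : (0 : ℝ) < p := by exact_mod_cast (by omega : 0 < p)
  have hc := waveSpeed_pos hh
  have hφ := wavenumber_pos hp hh
  have hle : ∀ j : ℕ, Om p h j ≤ √(j + wavenumber p h) := fun j => by
    apply Real.sqrt_le_sqrt
    have h1 : (0 : ℝ) ≤ j + wavenumber p h := by positivity
    exact mul_le_of_le_one_right h1 (Real.tanh_lt_one _).le
  have h0 := hle 0
  have h1 := hle p
  rw [Nat.cast_zero, zero_add] at h0
  have h2 := Om_add hp hh
  set a := √(wavenumber p h)
  set b := √(p + wavenumber p h)
  have ha : a ^ 2 = wavenumber p h := Real.sq_sqrt hφ.le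
  have hb : b ^ 2 = p + wavenumber p h := Real.sq_sqrt (by positivity)
  have h3 : (p : ℝ) * waveSpeed h ≤ a + b := by linarith
  have h4 : a ≤ b := Real.sqrt_le_sqrt (by linarith)
  have h5 : b - a ≤ 1 / waveSpeed h := by
    rw [le_div_iff₀ hc]
    have h6 : (b - a) * (p * waveSpeed h) ≤ p := by nlinarith
    nlinarith
  linarith

end collision

section moments

variable {p : ℕ} {h : ℝ}

/-- The denominator `(j c_h - Ω_0)² - Ω_j²` common to both propagators of the harmonic `j`. -/
def detuning (p : ℕ) (h : ℝ) (j : ℕ) : ℝ :=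
  (j * waveSpeed h - Om p h 0) ^ 2 - (j + wavenumber p h) * tanhAt p h j

theorem moments_eq (hp : 2 ≤ p) (hh : 0 < h) (j : ℕ) (hd : detuning p h j ≠ 0) :
    moment0 p h j = (j + wavenumber p h) * tanhAt p h j / (2 * detuning p h j) ∧
    moment1 p h j = (j + wavenumber p h) * (j * waveSpeed h - Om p h 0) / (2 * detuning p h j) ∧
    moment2 p h j = (j + wavenumber p h) ^ 2 / (2 * detuning p h j) := by
  have hT := tanhAt_pos hp hh j
  have hsq := Om_sq hp hh j
  have hdet : detuning p h j = (j * waveSpeed h - Om p h 0 - Om p h j) *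
      (j * waveSpeed h - Om p h 0 + Om p h j) := by
    rw [detuning, ← hsq]
    ring
  have hk : (j : ℝ) + wavenumber p h = Om p h j ^ 2 / tanhAt p h j := by
    rw [hsq]
    field_simp
  have hp1 : propagator p h j 1 = Om p h j / (4 * (j * waveSpeed h - Om p h 0 - Om p h j)) := by
    rw [propagator]
    ring_nf
  have hp2 : propagator p h j (-1) =
      Om p h j / (4 * (j * waveSpeed h - Om p h 0 + Om p h j)) := by
    rw [propagator]
    ring_nf
  rw [hdet] at hd
  have hd1 := left_ne_zero_of_mul hd
  have hd2 := right_ne_zero_of_mul hd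
  rw [moment0, moment1, moment2, tt_eq hp hh, hp1, hp2, hdet, hk]
  generalize (j : ℝ) * waveSpeed h - Om p h 0 = D at *
  generalize Om p h j = w at *
  generalize tanhAt p h j = T at *
  refine ⟨?_, ?_, ?_⟩ <;> field_simp <;> ring

end moments

section expansions

variable {x e : ℝ → ℝ} {p : ℕ}

theorem tanh_eq_exp (u : ℝ) :
    Real.tanh u = (1 - Real.exp (-(2 * u))) / (1 + Real.exp (-(2 * u))) := by
  have h1 : Real.exp (-(2 * u)) = Real.exp (-u) / Real.exp u := by
    rw [← Real.exp_sub]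
    ring_nf
  have := Real.exp_pos u
  have := Real.exp_pos (-u)
  rw [Real.tanh_eq, h1]
  field_simp

theorem firstOrder_tanh {u : ℝ → ℝ} {b : ℝ} (hs : IsScale x e)
    (hu : FirstOrder x e (fun h => Real.exp (-(2 * u h))) 0 b) :
    FirstOrder x e (fun h => Real.tanh (u h)) 1 (-2 * b) := by
  have h1 := ((FirstOrder.const 1).sub hu).div hs ((FirstOrder.const 1).add hu) (by norm_num)
  refine (h1.congr' (Eventually.of_forall fun h => (tanh_eq_exp _).symm)).of_eq ?_ ?_ <;> ring

theorem firstOrder_waveSpeed {b : ℝ} (hs : IsScale x e)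
    (hu : FirstOrder x e (fun h => Real.exp (-(2 * h))) 0 b) :
    FirstOrder x e waveSpeed 1 (-b) := by
  refine ((firstOrder_tanh hs hu).sqrt hs one_pos).of_eq Real.sqrt_one ?_
  rw [Real.sqrt_one]
  ring

/-- First-order expansion of `Ω_0`, given that of `c_h` and of the hyperbolic tangents at `φ(p, h)`
and `p + φ(p, h)`. -/
theorem firstOrder_Om_zero (hp : 2 ≤ p) {c τ : ℝ} (hs : IsScale x e)
    (hc : FirstOrder x e waveSpeed 1 c) (h0 : FirstOrder x e (tanhAt p · 0) 1 τ)
    (h1 : FirstOrder x e (tanhAt p · p) 1 0) :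
    FirstOrder x e (Om p · 0) ((p - 1) / 2)
      (((p : ℝ) ^ 2 * c + τ * ((p - 1) / 2) ^ 2 + p * c) / (2 * p)) := by
  have hp0 : (0 : ℝ) < p := by exact_mod_cast (by omega : 0 < p)
  have hbd : ∀ᶠ h in atTop, 0 ≤ Om p h 0 ∧ Om p h 0 ≤ p := by
    filter_upwards [eventually_gt_atTop 0] with h hh
    have h2 := Om_add hp hh
    have h3 := waveSpeed_le_one h
    have h4 := Om_pos hp hh p
    refine ⟨(Om_pos hp hh 0).le, ?_⟩
    nlinarith
  have hb1 : (fun h => Om p h 0 ^ 2) =O[atTop] (fun _ => (1 : ℝ)) := by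
    refine IsBigO.of_bound ((p : ℝ) ^ 2) ?_
    filter_upwards [hbd] with h hh
    simp only [norm_one, mul_one, Real.norm_eq_abs, abs_pow, abs_of_nonneg hh.1]
    exact pow_le_pow_left₀ hh.1 hh.2 2
  have hb2 : (fun h => (p * waveSpeed h - Om p h 0) ^ 2) =O[atTop]
      (fun _ => (1 : ℝ)) := by
    refine IsBigO.of_bound ((p : ℝ) ^ 2) ?_
    filter_upwards [hbd, eventually_gt_atTop 0] with h hh hpos
    have h2 := Om_add hp hpos
    have h3 := waveSpeed_le_one h
    have h4 := Om_pos hp hpos p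
    simp only [norm_one, mul_one, Real.norm_eq_abs, abs_pow]
    refine pow_le_pow_left₀ (abs_nonneg _) ?_ 2
    rw [abs_of_nonneg (by linarith)]
    nlinarith [hh.1]
  -- The general step: an expansion of the first product gives one of `Ω_0`.
  have key : ∀ {e' : ℝ → ℝ} {c' b : ℝ}, IsScale x e' → FirstOrder x e' waveSpeed 1 c' →
      FirstOrder x e' (fun h => (1 - 1 / tanhAt p h 0) * Om p h 0 ^ 2) 0 b →
      FirstOrder x e' (tanhAt p · p) 1 0 →
      FirstOrder x e' (Om p · 0) ((p - 1) / 2) (((p : ℝ) ^ 2 * c' + b + p * c') / (2 * p)) := by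
    intro e' c' b hs' hc' hb' h1'
    have h2 : FirstOrder x e' (fun h => 1 - 1 / tanhAt p h p) 0 0 :=
      ((FirstOrder.const 1).sub ((FirstOrder.const 1).div hs' h1' one_ne_zero)).of_eq
        (by norm_num) (by norm_num)
    have h3 := h2.mul_bounded hb2
    have h4 := (((((FirstOrder.const ((p : ℝ) ^ 2)).mul hs' (hc'.pow hs' 2)).sub
      (.const (p : ℝ))).add hb').sub h3).div hs' ((FirstOrder.const (2 * (p : ℝ))).mul hs' hc')
      (by positivity)
    refine (h4.congr' ?_).of_eq ?_ ?_
    · filter_upwards [eventually_gt_atTop 0] with h hh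
      exact (Om_zero_eq hp hh).symm
    · field_simp
      ring
    · field_simp
      ring
  have hinv : FirstOrder x e (fun h => 1 - 1 / tanhAt p h 0) 0 τ :=
    ((FirstOrder.const 1).sub ((FirstOrder.const 1).div hs h0 one_ne_zero)).of_eq
      (by norm_num) (by norm_num)
  have hlead : FirstOrder x x (Om p · 0) ((p - 1) / 2) 0 :=
    (key hs.self (hc.weaken hs) ((hinv.weaken hs).mul_bounded hb1) (h1.weaken hs)).weaken hs.self
  exact key hs hc (hinv.mul_small hs (hlead.pow hs.self 2)) h1

theorem firstOrder_wavenumber (hp : 2 ≤ p) {y₀ y₁ τ : ℝ} (hs : IsScale x e)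
    (hy : FirstOrder x e (Om p · 0) y₀ y₁) (h0 : FirstOrder x e (tanhAt p · 0) 1 τ) :
    FirstOrder x e (wavenumber p) (y₀ ^ 2) (2 * y₀ * y₁ - y₀ ^ 2 * τ) := by
  refine (((hy.pow hs 2).div hs h0 one_ne_zero).congr' ?_).of_eq (by ring) ?_
  · filter_upwards [eventually_gt_atTop 0] with h hh
    exact (wavenumber_eq hp hh).symm
  · norm_num

/-- First-order expansions of the three moments of an intermediate harmonic `j`, for which the
detuning tends to `j (j - p)` when `Ω_0` tends to `(p - 1) / 2`. -/
theorem firstOrder_moments (hp : 2 ≤ p) {y₀ y₁ c k₀ φ₁ d₀ d₁ : ℝ} (hs : IsScale x e)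
    (hc : FirstOrder x e waveSpeed 1 c) (hy : FirstOrder x e (Om p · 0) y₀ y₁) (j : ℕ)
    (hφ : FirstOrder x e (wavenumber p) (k₀ - j) φ₁)
    (hT : FirstOrder x e (tanhAt p · j) 1 0)
    (hd₀ : d₀ = (j - y₀) ^ 2 - k₀) (hd : d₀ ≠ 0)
    (hd₁ : d₁ = 2 * (j - y₀) * (j * c - y₁) - φ₁) :
    FirstOrder x e (moment0 p · j) (k₀ / (2 * d₀)) ((φ₁ * d₀ - k₀ * d₁) / (2 * d₀ ^ 2)) ∧
    FirstOrder x e (moment1 p · j) (k₀ * (j - y₀) / (2 * d₀))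
      (((k₀ * (j * c - y₁) + φ₁ * (j - y₀)) * d₀ - k₀ * (j - y₀) * d₁) / (2 * d₀ ^ 2)) ∧
    FirstOrder x e (moment2 p · j) (k₀ ^ 2 / (2 * d₀))
      ((2 * k₀ * φ₁ * d₀ - k₀ ^ 2 * d₁) / (2 * d₀ ^ 2)) := by
  have hk : FirstOrder x e (fun h => j + wavenumber p h) k₀ φ₁ :=
    ((FirstOrder.const (j : ℝ)).add hφ).of_eq (by ring) (by ring)
  have hD : FirstOrder x e (fun h => j * waveSpeed h - Om p h 0) (j - y₀)
      (j * c - y₁) :=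
    (((FirstOrder.const (j : ℝ)).mul hs hc).sub hy).of_eq (by ring) (by ring)
  have hdet : FirstOrder x e (detuning p · j) d₀ d₁ := by
    refine ((hD.pow hs 2).sub (hk.mul hs hT)).of_eq ?_ ?_
    · rw [hd₀]
      ring
    · rw [hd₁]
      norm_num
  have h2d := (FirstOrder.const (2 : ℝ)).mul hs hdet
  have h2 : 2 * d₀ ≠ 0 := mul_ne_zero two_ne_zero hd
  have hev : ∀ᶠ h in atTop, 0 < h ∧ detuning p h j ≠ 0 :=
    (eventually_gt_atTop 0).and ((hdet.tendsto hs).eventually_ne hd)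
  refine ⟨?_, ?_, ?_⟩
  · refine (((hk.mul hs hT).div hs h2d h2).congr' ?_).of_eq ?_ ?_
    · filter_upwards [hev] with h hh
      exact (moments_eq hp hh.1 j hh.2).1.symm
    · field_simp
    · field_simp
      ring
  · refine (((hk.mul hs hD).div hs h2d h2).congr' ?_).of_eq ?_ ?_
    · filter_upwards [hev] with h hh
      exact (moments_eq hp hh.1 j hh.2).2.1.symm
    · field_simp
    · field_simp
      ring
  · refine (((hk.pow hs 2).div hs h2d h2).congr' ?_).of_eq ?_ ?_
    · filter_upwards [hev] with h hh
      exact (moments_eq hp hh.1 j hh.2).2.2.symm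
    · field_simp
    · field_simp
      norm_num
      ring

end expansions
end
end StokesIsola

/-! ### Expansions of the ingredients in deep water -/

namespace StokesIsola
noncomputable section

section exponentials

theorem isBigO_exp_neg {a b : ℝ} (hab : b ≤ a) :
    (fun h : ℝ => Real.exp (-(a * h))) =O[atTop] (fun h => Real.exp (-(b * h))) := by
  refine IsBigO.of_bound 1 ?_
  filter_upwards [eventually_ge_atTop 0] with h hh
  rw [one_mul, Real.norm_eq_abs, Real.norm_eq_abs, Real.abs_exp, Real.abs_exp, Real.exp_le_exp]
  nlinarith

theorem isBigO_mul_exp_neg {a b : ℝ} (hab : b < a) :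
    (fun h : ℝ => h * Real.exp (-(a * h))) =O[atTop] (fun h => Real.exp (-(b * h))) := by
  have hd : 0 < a - b := sub_pos.2 hab
  refine IsBigO.of_bound (1 / (a - b)) ?_
  filter_upwards [eventually_ge_atTop 0] with h hh
  rw [Real.norm_eq_abs, Real.norm_eq_abs, Real.abs_exp, abs_mul, Real.abs_exp, abs_of_nonneg hh]
  have h1 : (a - b) * h ≤ Real.exp ((a - b) * h) := by
    linarith [Real.add_one_le_exp ((a - b) * h)]
  have h2 : Real.exp (-(b * h)) = Real.exp ((a - b) * h) * Real.exp (-(a * h)) := by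
    rw [← Real.exp_add]
    ring_nf
  rw [h2, ← mul_assoc]
  refine mul_le_mul_of_nonneg_right ?_ (Real.exp_pos _).le
  rw [div_mul_eq_mul_div, one_mul, le_div_iff₀ hd]
  linarith

theorem isScale_exp {a b : ℝ} (ha : 0 < a) (hab : a ≤ b) (hba : b ≤ 2 * a) :
    IsScale (fun h => Real.exp (-(a * h))) (fun h => Real.exp (-(b * h))) where
  tendsto := Real.tendsto_exp_neg_atTop_nhds_zero.comp (tendsto_id.const_mul_atTop ha)
  sq := by
    refine (isBigO_exp_neg hba).congr_left fun h => ?_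
    rw [← Real.exp_add]
    ring_nf
  err := isBigO_exp_neg hab

theorem firstOrder_of_isBigO {x e f : ℝ → ℝ} (hf : f =O[atTop] e) : FirstOrder x e f 0 0 :=
  hf.congr_left fun h => by ring

end exponentials

section tails

variable {p : ℕ}

/-- The wavenumber is at least its deep-water value `((p - 1) / 2)²` up to `O(e^{-2h})`, so the
exponentials in the hyperbolic tangents are of the size they have in deep water. -/
theorem isBigO_exp_wavenumber (hp : 2 ≤ p) (j : ℕ) :
    (fun h => Real.exp (-(2 * (h * (j + wavenumber p h))))) =O[atTop]
      (fun h => Real.exp (-((2 * (j + (((p : ℝ) - 1) / 2) ^ 2)) * h))) := by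
  have hp2 : (2 : ℝ) ≤ p := by exact_mod_cast hp
  have hs : IsScale (fun h => Real.exp (-(2 * h))) (fun h => Real.exp (-(2 * h))) :=
    isScale_exp two_pos le_rfl (by norm_num)
  have hx : FirstOrder (fun h => Real.exp (-(2 * h))) (fun h => Real.exp (-(2 * h)))
      (fun h => Real.exp (-(2 * h))) 0 0 := firstOrder_of_isBigO (isBigO_refl _ _)
  have hc := firstOrder_waveSpeed hs hx
  have hL := (((FirstOrder.const (p : ℝ)).mul hs hc).sub
    ((FirstOrder.const 1).div hs hc one_ne_zero)).div hs (.const 2) two_ne_zero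
  have hpos := (hL.tendsto hs).eventually_const_lt (u := 0) (by linarith)
  have hL2 : FirstOrder _ _ _ ((((p : ℝ) - 1) / 2) ^ 2) 0 :=
    (hL.pow hs 2).of_eq (by ring) (by ring)
  obtain ⟨C, hC⟩ := (show _ =O[atTop] _ from hL2).bound
  refine IsBigO.of_bound (Real.exp (2 * |C|)) ?_
  filter_upwards [hpos, hC, eventually_gt_atTop 0] with h h1 h2 h3
  have h4 := le_sqrt_wavenumber hp h3
  have hφ := wavenumber_pos hp h3
  have h5 : ((p * waveSpeed h - 1 / waveSpeed h) / 2) ^ 2 ≤ wavenumber p h := by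
    rw [← Real.sq_sqrt hφ.le]
    exact pow_le_pow_left₀ h1.le h4 2
  rw [Real.norm_eq_abs, Real.norm_eq_abs, Real.abs_exp, zero_mul, add_zero] at h2
  have h6 : (((p : ℝ) - 1) / 2) ^ 2 - |C| * Real.exp (-(2 * h)) ≤ wavenumber p h := by
    have h7 := (abs_le.1 h2).1
    have h8 := mul_le_mul_of_nonneg_right (le_abs_self C) (Real.exp_pos (-(2 * h))).le
    linarith
  have h9 : h * Real.exp (-(2 * h)) ≤ 1 := by
    have h10 : Real.exp (-(2 * h)) = (Real.exp (2 * h))⁻¹ := Real.exp_neg _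
    rw [h10, ← div_eq_mul_inv, div_le_one (Real.exp_pos _)]
    linarith [Real.add_one_le_exp (2 * h)]
  rw [Real.norm_eq_abs, Real.norm_eq_abs, Real.abs_exp, Real.abs_exp, ← Real.exp_add,
    Real.exp_le_exp]
  have h11 := mul_le_mul_of_nonneg_left h6 h3.le
  have h12 := mul_le_mul_of_nonneg_left h9 (abs_nonneg C)
  nlinarith

theorem firstOrder_tanhAt {x e : ℝ → ℝ} (hp : 2 ≤ p) (hs : IsScale x e) (j : ℕ)
    (he : (fun h => Real.exp (-((2 * (j + (((p : ℝ) - 1) / 2) ^ 2)) * h))) =O[atTop] e) :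
    FirstOrder x e (tanhAt p · j) 1 0 :=
  (firstOrder_tanh hs (firstOrder_of_isBigO ((isBigO_exp_wavenumber hp j).trans he))).of_eq rfl
    (by norm_num)

/-- In the exponential `e^{-2hφ}` the wavenumber may be replaced by its limit. -/
theorem firstOrder_tanhAt_zero {a b : ℝ} (hp : 2 ≤ p) (ha : 2 * (((p : ℝ) - 1) / 2) ^ 2 = a)
    (hb : b < 2 * a) (hs : IsScale (fun h => Real.exp (-(a * h))) (fun h => Real.exp (-(b * h))))
    (hc : FirstOrder (fun h => Real.exp (-(a * h))) (fun h => Real.exp (-(a * h))) waveSpeed 1 0)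
    (hT : FirstOrder (fun h => Real.exp (-(a * h))) (fun h => Real.exp (-(a * h)))
      (tanhAt p · p) 1 0) :
    FirstOrder (fun h => Real.exp (-(a * h))) (fun h => Real.exp (-(b * h))) (tanhAt p · 0) 1
      (-2) := by
  have hp2 : (2 : ℝ) ≤ p := by exact_mod_cast hp
  have hapos : 0 < a := by
    rw [← ha]
    have : 0 < ((p : ℝ) - 1) / 2 := by linarith
    positivity
  have h0 : FirstOrder (fun h => Real.exp (-(a * h))) (fun h => Real.exp (-(a * h)))
      (tanhAt p · 0) 1 0 := by
    refine firstOrder_tanhAt hp hs.self 0 ?_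
    rw [Nat.cast_zero, zero_add, ha]
  have hy := firstOrder_Om_zero hp hs.self hc h0 hT
  have hφ : FirstOrder (fun h => Real.exp (-(a * h))) (fun h => Real.exp (-(a * h)))
      (wavenumber p) ((((p : ℝ) - 1) / 2) ^ 2) 0 :=
    (firstOrder_wavenumber hp hs.self hy h0).weaken hs.self
  refine (firstOrder_tanh (u := fun h => h * (((0 : ℕ) : ℝ) + wavenumber p h)) (b := 1) hs
    ?_).of_eq rfl (by norm_num)
  have hdev : (fun h => -(2 * (h * (wavenumber p h - (((p : ℝ) - 1) / 2) ^ 2)))) =O[atTop]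
      (fun h => h * Real.exp (-(a * h))) := by
    have h1 := (isBigO_refl (fun h : ℝ => h) atTop).mul hφ
    exact (h1.const_mul_left (-2)).congr_left fun h => by ring
  have hlim : Tendsto (fun h => -(2 * (h * (wavenumber p h - (((p : ℝ) - 1) / 2) ^ 2)))) atTop
      (nhds 0) := by
    refine hdev.trans_tendsto ((isBigO_mul_exp_neg (half_lt_self hapos)).trans_tendsto ?_)
    exact Real.tendsto_exp_neg_atTop_nhds_zero.comp (tendsto_id.const_mul_atTop (half_pos hapos))
  have hexp : (fun h => Real.exp (-(2 * (h * (wavenumber p h - (((p : ℝ) - 1) / 2) ^ 2)))) - 1)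
      =O[atTop] (fun h => h * Real.exp (-(a * h))) := by
    refine IsBigO.trans (IsBigO.of_bound 2 ?_) hdev
    have hlim' := hlim.abs
    rw [abs_zero] at hlim'
    filter_upwards [hlim'.eventually_le_const one_pos] with h hh
    exact Real.abs_exp_sub_one_le hh
  have hprod := (isBigO_refl (fun h => Real.exp (-(a * h))) atTop).mul hexp
  refine (hprod.trans ?_).congr_left fun h => ?_
  · refine (isBigO_mul_exp_neg hb).congr_left fun h => ?_
    rw [mul_left_comm, ← Real.exp_add]
    ring_nf
  · rw [mul_sub, ← Real.exp_add, ← ha, Nat.cast_zero]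
    ring_nf

end tails

section coefficients

variable {x e : ℝ → ℝ} {c : ℝ}

theorem firstOrder_aCoeff_one (hs : IsScale x e) (hc : FirstOrder x e waveSpeed 1 c) :
    FirstOrder x e (aCoeff 1) (-2) 0 :=
  ((hc.pow hs 2).add ((hc.pow hs 2).inv hs (by norm_num))).neg.of_eq (by norm_num) (by norm_num)

theorem firstOrder_aCoeff_two (hs : IsScale x e) (hc : FirstOrder x e waveSpeed 1 c) :
    FirstOrder x e (aCoeff 2) (-2) (20 * c) :=
  (((((FirstOrder.const (-14)).mul hs (hc.pow hs 4)).add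
    ((FirstOrder.const 9).mul hs (hc.pow hs 8))).sub (.const 3)).div hs
    ((FirstOrder.const 4).mul hs (hc.pow hs 8)) (by norm_num)).of_eq (by norm_num)
    (by norm_num; ring)

theorem firstOrder_aCoeff_three (hs : IsScale x e) (hc : FirstOrder x e waveSpeed 1 c) :
    FirstOrder x e (aCoeff 3) (-3) (35 * c) :=
  ((((((hc.pow hs 16).neg.sub ((FirstOrder.const 98).mul hs (hc.pow hs 12))).add
    ((FirstOrder.const 252).mul hs (hc.pow hs 8))).sub
    ((FirstOrder.const 318).mul hs (hc.pow hs 4))).sub (.const 27)).div hs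
    ((FirstOrder.const 64).mul hs (hc.pow hs 14)) (by norm_num)).of_eq (by norm_num)
    (by norm_num; ring)

theorem firstOrder_aCoeff_four (hs : IsScale x e) (hc : FirstOrder x e waveSpeed 1 c) :
    FirstOrder x e (aCoeff 4) (-(16 / 3)) (698 / 9 * c) :=
  (((((((((FirstOrder.const 9).mul hs (hc.pow hs 24)).add
    ((FirstOrder.const 238).mul hs (hc.pow hs 20))).sub
    ((FirstOrder.const 233).mul hs (hc.pow hs 16))).sub
    ((FirstOrder.const 1676).mul hs (hc.pow hs 12))).add
    ((FirstOrder.const 743).mul hs (hc.pow hs 8))).sub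
    ((FirstOrder.const 3042).mul hs (hc.pow hs 4))).sub (.const 135)).div hs
    (((FirstOrder.const 128).mul hs (hc.pow hs 20)).mul hs ((hc.pow hs 4).add (.const 5)))
    (by norm_num)).of_eq (by norm_num) (by norm_num; ring)

theorem firstOrder_pCoeff_one (hs : IsScale x e) (hc : FirstOrder x e waveSpeed 1 c) :
    FirstOrder x e (pCoeff 1) (-2) (2 * c) :=
  ((FirstOrder.const (-2)).mul hs (hc.inv hs one_ne_zero)).of_eq (by norm_num) (by norm_num)

theorem firstOrder_pCoeff_two (hs : IsScale x e) (hc : FirstOrder x e waveSpeed 1 c) :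
    FirstOrder x e (pCoeff 2) (-2) (12 * c) :=
  (((FirstOrder.const 3).add (hc.pow hs 4)).div hs ((FirstOrder.const 2).mul hs (hc.pow hs 7))
    (by norm_num)).neg.of_eq (by norm_num) (by norm_num; ring)

theorem firstOrder_pCoeff_three (hs : IsScale x e) (hc : FirstOrder x e waveSpeed 1 c) :
    FirstOrder x e (pCoeff 3) (-3) (28 * c) :=
  (((((hc.pow hs 12).add ((FirstOrder.const 17).mul hs (hc.pow hs 8))).add
    ((FirstOrder.const 51).mul hs (hc.pow hs 4))).add (.const 27)).div hs
    ((FirstOrder.const 32).mul hs (hc.pow hs 13)) (by norm_num)).neg.of_eq (by norm_num)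
    (by norm_num; ring)

theorem firstOrder_pCoeff_four (hs : IsScale x e) (hc : FirstOrder x e waveSpeed 1 c) :
    FirstOrder x e (pCoeff 4) (-(16 / 3)) (605 / 9 * c) :=
  ((((((((hc.pow hs 20).neg.sub ((FirstOrder.const 39).mul hs (hc.pow hs 16))).sub
    ((FirstOrder.const 366).mul hs (hc.pow hs 12))).sub
    ((FirstOrder.const 850).mul hs (hc.pow hs 8))).sub
    ((FirstOrder.const 657).mul hs (hc.pow hs 4))).sub (.const 135))).div hs
    (((FirstOrder.const 64).mul hs (hc.pow hs 19)).mul hs ((hc.pow hs 4).add (.const 5)))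
    (by norm_num)).of_eq (by norm_num) (by norm_num; ring)

end coefficients

section transfer

variable {x e : ℝ → ℝ} {p : ℕ}

theorem firstOrder_tt_zero (hp : 2 ≤ p) {y₀ y₁ τ : ℝ} (hs : IsScale x e)
    (hy : FirstOrder x e (Om p · 0) y₀ y₁) (h0 : FirstOrder x e (tanhAt p · 0) 1 τ) :
    FirstOrder x e (tt p · 0) y₀ (y₁ - y₀ * τ) := by
  refine ((hy.div hs h0 one_ne_zero).congr' ?_).of_eq (by norm_num) (by norm_num)
  filter_upwards [eventually_gt_atTop 0] with h hh
  exact (tt_eq hp hh 0).symm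

theorem firstOrder_Om_last (hp : 2 ≤ p) {y₀ y₁ c : ℝ} (hs : IsScale x e)
    (hc : FirstOrder x e waveSpeed 1 c) (hy : FirstOrder x e (Om p · 0) y₀ y₁) :
    FirstOrder x e (Om p · p) (p - y₀) (p * c - y₁) := by
  refine ((((FirstOrder.const (p : ℝ)).mul hs hc).sub hy).congr' ?_).of_eq (by ring) (by ring)
  filter_upwards [eventually_gt_atTop 0] with h hh
  linarith [Om_add hp hh]

theorem firstOrder_tt_last (hp : 2 ≤ p) {y₀ y₁ : ℝ} (hs : IsScale x e)
    (hy : FirstOrder x e (Om p · p) y₀ y₁) (h1 : FirstOrder x e (tanhAt p · p) 1 0) :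
    FirstOrder x e (tt p · p) y₀ y₁ := by
  refine ((hy.div hs h1 one_ne_zero).congr' ?_).of_eq (by norm_num) (by norm_num)
  filter_upwards [eventually_gt_atTop 0] with h hh
  exact (tt_eq hp hh p).symm

theorem firstOrder_pass (hs : IsScale x e) {f g A B : ℝ → ℝ} {f₀ f₁ g₀ g₁ A₀ A₁ B₀ B₁ r₀ r₁ : ℝ}
    (hf : FirstOrder x e f f₀ f₁) (hg : FirstOrder x e g g₀ g₁)
    (hA : FirstOrder x e A A₀ A₁) (hB : FirstOrder x e B B₀ B₁)
    (h₀ : f₀ * A₀ + g₀ * B₀ = r₀)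
    (h₁ : f₀ * A₁ + f₁ * A₀ + (g₀ * B₁ + g₁ * B₀) = r₁) :
    FirstOrder x e (fun h => f h * A h + g h * B h) r₀ r₁ :=
  ((hf.mul hs hA).add (hg.mul hs hB)).of_eq h₀ h₁

/-- A chain sum that vanishes in the limit is multiplied by the limit of the amplitude only. -/
theorem firstOrder_amplitude_mul (hs : IsScale x e) {y₀ y₁ z₀ z₁ s : ℝ} {S : ℝ → ℝ}
    (h0 : FirstOrder x e (Om p · 0) y₀ y₁) (h1 : FirstOrder x e (Om p · p) z₀ z₁)
    (hpos : 0 < y₀ * z₀) (hS : FirstOrder x e S 0 s) :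
    FirstOrder x e (fun h => amplitude p h * S h) 0 (√(y₀ * z₀) / 4 * s) :=
  (((FirstOrder.const (1 / 4)).mul hs ((h0.mul hs h1).sqrt hs hpos)).mul hs hS).of_eq
    (by ring) (by ring)

end transfer
end
end StokesIsola

/-! ### The three expansions -/

namespace StokesIsola
noncomputable section

theorem betaTwo_asymptotic :
    (fun h : ℝ => betaTwo h - 3 * √3 / 64 * Real.exp (-h / 2))
      =O[atTop] (fun h : ℝ => Real.exp (-(3 * h) / 4)) := by
  have hp : 2 ≤ 2 := le_rfl
  have hs : IsScale (fun h => Real.exp (-(1 / 2 * h))) (fun h => Real.exp (-(3 / 4 * h))) :=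
    isScale_exp (by norm_num) (by norm_num) (by norm_num)
  have hc := (firstOrder_waveSpeed hs (firstOrder_of_isBigO (isBigO_exp_neg (by norm_num)))).of_eq
    (rfl : (1 : ℝ) = 1) (neg_zero : -(0 : ℝ) = 0)
  have hT1 := firstOrder_tanhAt hp hs 1 (isBigO_exp_neg (by norm_num))
  have hT2 := firstOrder_tanhAt hp hs 2 (isBigO_exp_neg (by norm_num))
  have hT0 := firstOrder_tanhAt_zero hp (by norm_num) (by norm_num) hs (hc.weaken hs)
    (hT2.weaken hs)
  have hy := (firstOrder_Om_zero hp hs hc hT0 hT2).of_eq (a' := 1 / 2) (b' := -1 / 8)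
    (by norm_num) (by norm_num)
  have hφ := (firstOrder_wavenumber hp hs hy hT0).of_eq (a' := 1 / 4) (b' := 3 / 8)
    (by norm_num) (by norm_num)
  have hz := (firstOrder_Om_last hp hs hc hy).of_eq (a' := 3 / 2) (b' := 1 / 8)
    (by norm_num) (by norm_num)
  have ht0 := firstOrder_tt_zero hp hs hy hT0
  have ht2 := firstOrder_tt_last hp hs hz hT2
  have ha1 := firstOrder_aCoeff_one hs hc
  have hp1 := firstOrder_pCoeff_one hs hc
  have ha2 := firstOrder_aCoeff_two hs hc
  have hp2 := firstOrder_pCoeff_two hs hc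
  obtain ⟨m0, m1, m2⟩ := firstOrder_moments hp (k₀ := 5 / 4) hs hc hy 1
    (hφ.of_eq (by norm_num) rfl) hT1 rfl (by norm_num) rfl
  have hA1 : FirstOrder _ _ (chainA1 2) (-3) (-7 / 4) :=
    (ha1.add (hp1.mul hs ht0)).of_eq (by norm_num) (by norm_num)
  have hB1 : FirstOrder _ _ chainB1 2 0 := hp1.neg.of_eq (by norm_num) (by norm_num)
  have hU1 : FirstOrder _ _ (chainU1 2) (5 / 4) 1 :=
    firstOrder_pass hs m0 m1 hA1 hB1 (by norm_num) (by norm_num)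
  have hW1 : FirstOrder _ _ (chainW1 2) (-5 / 8) (9 / 32) :=
    firstOrder_pass hs m1 m2 hA1 hB1 (by norm_num) (by norm_num)
  have hS : FirstOrder _ _ (fun h => chainA2 2 h + chainB2 2 h * tt 2 h 2) 0 (3 / 8) :=
    (((ha2.add (hp2.mul hs ht0)).add ((hU1.mul hs ha1).sub (hW1.mul hs hp1))).add
      ((hp2.neg.sub (hU1.mul hs hp1)).mul hs ht2)).of_eq (by norm_num) (by norm_num)
  have hβ := firstOrder_amplitude_mul hs hy hz (by norm_num) hS
  have h34 : √(1 / 2 * (3 / 2)) = √3 / 2 := by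
    rw [show (1 / 2 * (3 / 2) : ℝ) = 3 / 2 ^ 2 by norm_num, Real.sqrt_div (by norm_num),
      Real.sqrt_sq (by norm_num)]
  rw [h34] at hβ
  refine IsBigO.congr hβ (fun h => ?_) (fun h => ?_)
  · rw [betaTwo_eq, show -h / 2 = -(1 / 2 * h) by ring]
    ring
  · ring_nf

theorem betaThree_asymptotic :
    (fun h : ℝ => betaThree h - 2 * √2 / 3 * Real.exp (-2 * h))
      =O[atTop] (fun h : ℝ => Real.exp (-3 * h)) := by
  have hp : 2 ≤ 3 := by norm_num
  have hs : IsScale (fun h => Real.exp (-(2 * h))) (fun h => Real.exp (-(3 * h))) :=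
    isScale_exp (by norm_num) (by norm_num) (by norm_num)
  have hx : FirstOrder (fun h => Real.exp (-(2 * h))) (fun h => Real.exp (-(3 * h)))
      (fun h => Real.exp (-(2 * h))) 0 1 :=
    (isBigO_zero _ _).congr_left fun h => by ring
  have hc := firstOrder_waveSpeed hs hx
  have hT1 := firstOrder_tanhAt hp hs 1 (isBigO_exp_neg (by norm_num))
  have hT2 := firstOrder_tanhAt hp hs 2 (isBigO_exp_neg (by norm_num))
  have hT3 := firstOrder_tanhAt hp hs 3 (isBigO_exp_neg (by norm_num))
  have hT0 := firstOrder_tanhAt_zero hp (by norm_num) (by norm_num) hs (hc.weaken hs)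
    (hT3.weaken hs)
  have hy := (firstOrder_Om_zero hp hs hc hT0 hT3).of_eq (a' := 1) (b' := -7 / 3)
    (by norm_num) (by norm_num)
  have hφ := (firstOrder_wavenumber hp hs hy hT0).of_eq (a' := 1) (b' := -8 / 3)
    (by norm_num) (by norm_num)
  have hz := (firstOrder_Om_last hp hs hc hy).of_eq (a' := 2) (b' := -2 / 3)
    (by norm_num) (by norm_num)
  have ht0 := firstOrder_tt_zero hp hs hy hT0
  have ht3 := firstOrder_tt_last hp hs hz hT3
  have ha1 := firstOrder_aCoeff_one hs hc
  have hp1 := firstOrder_pCoeff_one hs hc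
  have ha2 := firstOrder_aCoeff_two hs hc
  have hp2 := firstOrder_pCoeff_two hs hc
  have ha3 := firstOrder_aCoeff_three hs hc
  have hp3 := firstOrder_pCoeff_three hs hc
  obtain ⟨m0, m1, m2⟩ := firstOrder_moments hp (k₀ := 2) hs hc hy 1
    (hφ.of_eq (by norm_num) rfl) hT1 rfl (by norm_num) rfl
  obtain ⟨n0, n1, n2⟩ := firstOrder_moments hp (k₀ := 3) hs hc hy 2
    (hφ.of_eq (by norm_num) rfl) hT2 rfl (by norm_num) rfl
  have hA1 : FirstOrder _ _ (chainA1 3) (-4) (-4 / 3) :=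
    (ha1.add (hp1.mul hs ht0)).of_eq (by norm_num) (by norm_num)
  have hB1 : FirstOrder _ _ chainB1 2 2 := hp1.neg.of_eq (by norm_num) (by norm_num)
  have hU1 : FirstOrder _ _ (chainU1 3) 2 (-2 / 3) :=
    firstOrder_pass hs m0 m1 hA1 hB1 (by norm_num) (by norm_num)
  have hW1 : FirstOrder _ _ (chainW1 3) (-2) (10 / 3) :=
    firstOrder_pass hs m1 m2 hA1 hB1 (by norm_num) (by norm_num)
  have hA2 : FirstOrder _ _ (chainA2 3) (-12) (-82 / 3) :=
    ((ha2.add (hp2.mul hs ht0)).add ((hU1.mul hs ha1).sub (hW1.mul hs hp1))).of_eq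
      (by norm_num) (by norm_num)
  have hB2 : FirstOrder _ _ (chainB2 3) 6 (44 / 3) :=
    (hp2.neg.sub (hU1.mul hs hp1)).of_eq (by norm_num) (by norm_num)
  have hU2 : FirstOrder _ _ (chainU2 3) (9 / 2) (23 / 2) :=
    firstOrder_pass hs n0 n1 hA2 hB2 (by norm_num) (by norm_num)
  have hW2 : FirstOrder _ _ (chainW2 3) (-9 / 2) (-1) :=
    firstOrder_pass hs n1 n2 hA2 hB2 (by norm_num) (by norm_num)
  have hS : FirstOrder _ _ (fun h => chainA3 3 h + chainB3 3 h * tt 3 h 3) 0 (8 / 3) :=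
    ((((ha3.add (hp3.mul hs ht0)).add ((hU1.mul hs ha2).sub (hW1.mul hs hp2))).add
      ((hU2.mul hs ha1).sub (hW2.mul hs hp1))).add
      (((hp3.neg.sub (hU1.mul hs hp2)).sub (hU2.mul hs hp1)).mul hs ht3)).of_eq
      (by norm_num) (by norm_num)
  have hβ := firstOrder_amplitude_mul hs hy hz (by norm_num) hS
  refine IsBigO.congr hβ (fun h => ?_) (fun h => ?_)
  · rw [betaThree_eq, one_mul, neg_mul]
    ring
  · rw [neg_mul]

theorem betaFour_asymptotic :
    (fun h : ℝ => betaFour h - (-(5 * √5 / (8 * √3))) * Real.exp (-2 * h))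
      =O[atTop] (fun h : ℝ => Real.exp (-4 * h)) := by
  have hp : 2 ≤ 4 := by norm_num
  have hs : IsScale (fun h => Real.exp (-(2 * h))) (fun h => Real.exp (-(4 * h))) :=
    isScale_exp (by norm_num) (by norm_num) (by norm_num)
  have hx : FirstOrder (fun h => Real.exp (-(2 * h))) (fun h => Real.exp (-(4 * h)))
      (fun h => Real.exp (-(2 * h))) 0 1 :=
    (isBigO_zero _ _).congr_left fun h => by ring
  have hc := firstOrder_waveSpeed hs hx
  -- Here `e^{-2hφ}` is of size `e^{-9h/2}`, so all the hyperbolic tangents are `1` up to the error.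
  have hT0 := firstOrder_tanhAt hp hs 0 (isBigO_exp_neg (by norm_num))
  have hT1 := firstOrder_tanhAt hp hs 1 (isBigO_exp_neg (by norm_num))
  have hT2 := firstOrder_tanhAt hp hs 2 (isBigO_exp_neg (by norm_num))
  have hT3 := firstOrder_tanhAt hp hs 3 (isBigO_exp_neg (by norm_num))
  have hT4 := firstOrder_tanhAt hp hs 4 (isBigO_exp_neg (by norm_num))
  have hy := (firstOrder_Om_zero hp hs hc hT0 hT4).of_eq (a' := 3 / 2) (b' := -5 / 2)
    (by norm_num) (by norm_num)
  have hφ := (firstOrder_wavenumber hp hs hy hT0).of_eq (a' := 9 / 4) (b' := -15 / 2)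
    (by norm_num) (by norm_num)
  have hz := (firstOrder_Om_last hp hs hc hy).of_eq (a' := 5 / 2) (b' := -3 / 2)
    (by norm_num) (by norm_num)
  have ht0 := firstOrder_tt_zero hp hs hy hT0
  have ht4 := firstOrder_tt_last hp hs hz hT4
  have ha1 := firstOrder_aCoeff_one hs hc
  have hp1 := firstOrder_pCoeff_one hs hc
  have ha2 := firstOrder_aCoeff_two hs hc
  have hp2 := firstOrder_pCoeff_two hs hc
  have ha3 := firstOrder_aCoeff_three hs hc
  have hp3 := firstOrder_pCoeff_three hs hc
  have ha4 := firstOrder_aCoeff_four hs hc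
  have hp4 := firstOrder_pCoeff_four hs hc
  obtain ⟨l0, l1, l2⟩ := firstOrder_moments hp (k₀ := 13 / 4) hs hc hy 1
    (hφ.of_eq (by norm_num) rfl) hT1 rfl (by norm_num) rfl
  obtain ⟨m0, m1, m2⟩ := firstOrder_moments hp (k₀ := 17 / 4) hs hc hy 2
    (hφ.of_eq (by norm_num) rfl) hT2 rfl (by norm_num) rfl
  obtain ⟨n0, n1, n2⟩ := firstOrder_moments hp (k₀ := 21 / 4) hs hc hy 3
    (hφ.of_eq (by norm_num) rfl) hT3 rfl (by norm_num) rfl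
  have hA1 : FirstOrder _ _ (chainA1 4) (-5) 2 :=
    (ha1.add (hp1.mul hs ht0)).of_eq (by norm_num) (by norm_num)
  have hB1 : FirstOrder _ _ chainB1 2 2 := hp1.neg.of_eq (by norm_num) (by norm_num)
  have hU1 : FirstOrder _ _ (chainU1 4) (13 / 4) (-19 / 6) :=
    firstOrder_pass hs l0 l1 hA1 hB1 (by norm_num) (by norm_num)
  have hW1 : FirstOrder _ _ (chainW1 4) (-39 / 8) (257 / 24) :=
    firstOrder_pass hs l1 l2 hA1 hB1 (by norm_num) (by norm_num)
  have hA2 : FirstOrder _ _ (chainA2 4) (-85 / 4) (-15) :=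
    ((ha2.add (hp2.mul hs ht0)).add ((hU1.mul hs ha1).sub (hW1.mul hs hp1))).of_eq
      (by norm_num) (by norm_num)
  have hB2 : FirstOrder _ _ (chainB2 4) (17 / 2) (73 / 6) :=
    (hp2.neg.sub (hU1.mul hs hp1)).of_eq (by norm_num) (by norm_num)
  have hU2 : FirstOrder _ _ (chainU2 4) (289 / 32) (221 / 48) :=
    firstOrder_pass hs m0 m1 hA2 hB2 (by norm_num) (by norm_num)
  have hW2 : FirstOrder _ _ (chainW2 4) (-867 / 64) (2465 / 192) :=
    firstOrder_pass hs m1 m2 hA2 hB2 (by norm_num) (by norm_num)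
  have hA3 : FirstOrder _ _ (chainA3 4) (-2205 / 32) (-1407 / 8) :=
    (((ha3.add (hp3.mul hs ht0)).add ((hU1.mul hs ha2).sub (hW1.mul hs hp2))).add
      ((hU2.mul hs ha1).sub (hW2.mul hs hp1))).of_eq (by norm_num) (by norm_num)
  have hB3 : FirstOrder _ _ (chainB3 4) (441 / 16) (1407 / 16) :=
    ((hp3.neg.sub (hU1.mul hs hp2)).sub (hU2.mul hs hp1)).of_eq (by norm_num) (by norm_num)
  have hU3 : FirstOrder _ _ (chainU3 4) (3087 / 128) (1029 / 16) :=
    firstOrder_pass hs n0 n1 hA3 hB3 (by norm_num) (by norm_num)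
  have hW3 : FirstOrder _ _ (chainW3 4) (-9261 / 256) (-11025 / 256) :=
    firstOrder_pass hs n1 n2 hA3 hB3 (by norm_num) (by norm_num)
  have hS : FirstOrder _ _ (fun h => chainA4 4 h + chainB4 4 h * tt 4 h 4) 0 (-5 / 3) :=
    (((((ha4.add (hp4.mul hs ht0)).add ((hU1.mul hs ha3).sub (hW1.mul hs hp3))).add
      ((hU2.mul hs ha2).sub (hW2.mul hs hp2))).add ((hU3.mul hs ha1).sub (hW3.mul hs hp1))).add
      ((((hp4.neg.sub (hU1.mul hs hp3)).sub (hU2.mul hs hp2)).sub (hU3.mul hs hp1)).mul hs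
      ht4)).of_eq (by norm_num) (by norm_num)
  have hβ := firstOrder_amplitude_mul hs hy hz (by norm_num) hS
  have h15 : √(3 / 2 * (5 / 2)) / 4 * (-5 / 3) = -(5 * √5 / (8 * √3)) := by
    rw [show (3 / 2 * (5 / 2) : ℝ) = 3 * 5 / 2 ^ 2 by norm_num, Real.sqrt_div (by norm_num),
      Real.sqrt_sq (by norm_num), Real.sqrt_mul (by norm_num)]
    have h3 : √(3 : ℝ) ≠ 0 := by positivity
    have h33 : √(3 : ℝ) ^ 2 = 3 := Real.sq_sqrt (by norm_num)
    field_simp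
    rw [h33]
    norm_num
  rw [h15] at hβ
  refine IsBigO.congr hβ (fun h => ?_) (fun h => ?_)
  · rw [betaFour_eq, neg_mul 2 h]
    ring
  · rw [neg_mul]

end
end StokesIsola

/-! ### Analyticity of the wavenumber up to the shallow-water limit -/

namespace StokesIsola
noncomputable section

section tanh

theorem analyticAt_tanh (x : ℝ) : AnalyticAt ℝ Real.tanh x := by
  have h1 : Real.tanh = fun x => Real.sinh x / Real.cosh x := by
    funext x
    exact Real.tanh_eq_sinh_div_cosh x
  rw [h1]
  exact Real.analyticAt_sinh.div Real.analyticAt_cosh (Real.cosh_pos x).ne'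

theorem hasDerivAt_tanh (x : ℝ) : HasDerivAt Real.tanh (1 / Real.cosh x ^ 2) x := by
  have h1 : Real.tanh = fun x => Real.sinh x / Real.cosh x := by
    funext x
    exact Real.tanh_eq_sinh_div_cosh x
  rw [h1]
  refine ((Real.hasDerivAt_sinh x).div (Real.hasDerivAt_cosh x)
    (Real.cosh_pos x).ne').congr_deriv ?_
  congr 1
  linarith [Real.cosh_sq x]

/-- `√(tanh x / x)`, extended by its limit `1` to `x = 0`. -/
def rootTanh (x : ℝ) : ℝ := √(dslope Real.tanh 0 x)

theorem mul_dslope_tanh (x : ℝ) : x * dslope Real.tanh 0 x = Real.tanh x := by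
  have h1 := sub_smul_dslope Real.tanh 0 x
  simpa using h1

theorem dslope_tanh_pos (x : ℝ) : 0 < dslope Real.tanh 0 x := by
  have h1 := mul_dslope_tanh x
  rcases lt_trichotomy x 0 with hx | rfl | hx
  · have h2 : Real.tanh x < 0 := by simpa using tanh_mono hx
    nlinarith
  · rw [dslope_same, (hasDerivAt_tanh 0).deriv]
    simp
  · have h2 := tanh_pos hx
    nlinarith

theorem analyticAt_dslope_tanh (x : ℝ) : AnalyticAt ℝ (dslope Real.tanh 0) x := by
  rcases eq_or_ne x 0 with rfl | hx
  · obtain ⟨q, hq⟩ := analyticAt_tanh 0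
    exact ⟨_, hq.has_fpower_series_dslope_fslope⟩
  · refine ((analyticAt_tanh x).div analyticAt_id hx).congr ?_
    filter_upwards [isOpen_ne.mem_nhds hx] with y hy
    rw [Pi.div_apply, id, ← mul_dslope_tanh y, mul_div_cancel_left₀ _ hy]

theorem rootTanh_pos (x : ℝ) : 0 < rootTanh x := Real.sqrt_pos.2 (dslope_tanh_pos x)

theorem analyticAt_rootTanh (x : ℝ) : AnalyticAt ℝ rootTanh x :=
  (((analyticAt_dslope_tanh x).contDiffAt (n := ⊤)).sqrt (dslope_tanh_pos x).ne').analyticAt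

/-- `x √(tanh x / x)` is the odd analytic square root of `x tanh x`; it is strictly increasing, also
at `x = 0`. -/
theorem deriv_mul_rootTanh_pos {x : ℝ} (hx : 0 ≤ x) :
    0 < rootTanh x + x * deriv rootTanh x := by
  have hd := (analyticAt_rootTanh x).differentiableAt.hasDerivAt
  rcases hx.eq_or_lt with rfl | hx
  · simpa using rootTanh_pos 0
  · have h1 : HasDerivAt (fun y => (y * rootTanh y) ^ 2)
        (2 * (x * rootTanh x) * (rootTanh x + x * deriv rootTanh x)) x := by
      refine (((hasDerivAt_id x).mul hd).pow 2).congr_deriv ?_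
      simp
    have h2 : (fun y => (y * rootTanh y) ^ 2) = fun y => y * Real.tanh y := by
      funext y
      rw [mul_pow, rootTanh, Real.sq_sqrt (dslope_tanh_pos y).le, ← mul_dslope_tanh y]
      ring
    rw [h2] at h1
    have h3 := h1.unique ((hasDerivAt_id x).mul (hasDerivAt_tanh x))
    have h4 : 0 < 1 * Real.tanh x + id x * (1 / Real.cosh x ^ 2) := by
      have := tanh_pos hx
      have := Real.cosh_pos x
      simp only [id]
      positivity
    rw [← h3] at h4
    have h5 : 0 < 2 * (x * rootTanh x) := by
      have := rootTanh_pos x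
      positivity
    exact (pos_iff_pos_of_mul_pos h4).1 h5

end tanh

section rescaled

/-- `Ω(k, h) / √h`, extended analytically to all real `h` and `k`. -/
def scaledOmega (h k : ℝ) : ℝ := k * rootTanh (h * k)

theorem Omega_eq_scaledOmega {h k : ℝ} (hh : 0 ≤ h) (hk : 0 ≤ k) :
    Omega k h = √h * scaledOmega h k := by
  have h1 : k * Real.tanh (h * k) = h * (k ^ 2 * dslope Real.tanh 0 (h * k)) := by
    rw [← mul_dslope_tanh]
    ring
  rw [Omega, h1, Real.sqrt_mul hh, Real.sqrt_mul (sq_nonneg k), Real.sqrt_sq hk]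
  rfl

theorem waveSpeed_eq_Omega (h : ℝ) : waveSpeed h = Omega 1 h := by
  rw [waveSpeed, Omega, mul_one, one_mul]

theorem scaledOmega_lt {h x y : ℝ} (hh : 0 ≤ h) (hx : 0 ≤ x) (hxy : x < y) :
    scaledOmega h x < scaledOmega h y := by
  rcases hh.eq_or_lt with rfl | hpos
  · simp only [scaledOmega, zero_mul]
    exact mul_lt_mul_of_pos_right hxy (rootTanh_pos 0)
  · have h1 := Omega_lt hpos hx hxy
    rw [Omega_eq_scaledOmega hh hx, Omega_eq_scaledOmega hh (hx.trans hxy.le)] at h1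
    exact lt_of_mul_lt_mul_left h1 (Real.sqrt_nonneg h)

theorem analyticAt_scaledOmega {V : Type*} [NormedAddCommGroup V] [NormedSpace ℝ V]
    {f g : V → ℝ} {v : V} (hf : AnalyticAt ℝ f v) (hg : AnalyticAt ℝ g v) :
    AnalyticAt ℝ (fun w => scaledOmega (f w) (g w)) v :=
  hg.mul ((analyticAt_rootTanh _).comp (hf.mul hg))

theorem hasDerivAt_scaledOmega (h k : ℝ) :
    HasDerivAt (scaledOmega h) (rootTanh (h * k) + h * k * deriv rootTanh (h * k)) k := by
  have hd := (analyticAt_rootTanh (h * k)).differentiableAt.hasDerivAt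
  have h1 : HasDerivAt (fun y => h * y) h k := by simpa using (hasDerivAt_id k).const_mul h
  refine ((hasDerivAt_id k).mul (hd.comp k h1)).congr_deriv ?_
  simp only [id, Function.comp]
  ring

/-- The collision condition divided by `√h`: it stays meaningful in the shallow-water limit
`h = 0`. -/
def collisionFun (p : ℕ) (v : ℝ × ℝ) : ℝ :=
  scaledOmega v.1 v.2 + scaledOmega v.1 (v.2 + p) - p * scaledOmega v.1 1

theorem analyticAt_collisionFun (p : ℕ) (v : ℝ × ℝ) : AnalyticAt ℝ (collisionFun p) v :=
  ((analyticAt_scaledOmega analyticAt_fst analyticAt_snd).add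
    (analyticAt_scaledOmega analyticAt_fst (analyticAt_snd.add analyticAt_const))).sub
    (analyticAt_const.mul (analyticAt_scaledOmega analyticAt_fst analyticAt_const))

theorem collisionFun_lt (p : ℕ) {h x y : ℝ} (hh : 0 ≤ h) (hx : 0 ≤ x) (hxy : x < y) :
    collisionFun p (h, x) < collisionFun p (h, y) := by
  have h1 := scaledOmega_lt hh hx hxy
  have h2 : scaledOmega h (x + p) < scaledOmega h (y + p) :=
    scaledOmega_lt hh (by positivity) (by linarith)
  simp only [collisionFun]
  linarith

theorem wavenumber_zero (p : ℕ) : wavenumber p 0 = 0 := by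
  have h1 : collisionSet p 0 = Set.Ioi 0 := by
    ext φ
    simp [collisionSet, freq, waveSpeed, Omega]
  rw [wavenumber, h1, csInf_Ioi]

theorem wavenumber_nonneg {p : ℕ} (hp : 2 ≤ p) {h : ℝ} (hh : 0 ≤ h) : 0 ≤ wavenumber p h := by
  rcases hh.eq_or_lt with rfl | hpos
  · exact (wavenumber_zero p).ge
  · exact (wavenumber_pos hp hpos).le

theorem collisionFun_wavenumber {p : ℕ} (hp : 2 ≤ p) {h : ℝ} (hh : 0 ≤ h) :
    collisionFun p (h, wavenumber p h) = 0 := by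
  rcases hh.eq_or_lt with rfl | hpos
  · simp [collisionFun, wavenumber_zero, scaledOmega]
  · have h1 := (mem_collisionSet.1 (wavenumber_mem hp hpos)).2
    have h2 := wavenumber_nonneg hp hh
    rw [waveSpeed_eq_Omega, Omega_eq_scaledOmega hh h2,
      Omega_eq_scaledOmega hh (by positivity), Omega_eq_scaledOmega hh zero_le_one] at h1
    have h3 : √h * collisionFun p (h, wavenumber p h) = 0 := by
      simp only [collisionFun]
      linear_combination h1
    exact (mul_eq_zero.1 h3).resolve_left (Real.sqrt_pos.2 hpos).ne'

theorem tendsto_wavenumber_sq {p : ℕ} (hp : 2 ≤ p) (s₀ : ℝ) :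
    Tendsto (fun s => wavenumber p (s ^ 2)) (nhds s₀) (nhds (wavenumber p (s₀ ^ 2))) := by
  have hφ := wavenumber_nonneg hp (sq_nonneg s₀)
  have hcont : ∀ y, Tendsto (fun s : ℝ => collisionFun p (s ^ 2, y)) (nhds s₀)
      (nhds (collisionFun p (s₀ ^ 2, y))) := fun y => by
    have h1 : ContinuousAt (fun s : ℝ => (s ^ 2, y)) s₀ := by fun_prop
    exact (ContinuousAt.comp (f := fun s : ℝ => (s ^ 2, y)) (g := collisionFun p)
      (analyticAt_collisionFun p (s₀ ^ 2, y)).continuousAt h1).tendsto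
  refine tendsto_order.2 ⟨fun y hy => ?_, fun y hy => ?_⟩
  · rcases lt_or_ge y 0 with hy0 | hy0
    · exact Eventually.of_forall fun s => hy0.trans_le (wavenumber_nonneg hp (sq_nonneg s))
    · have h1 := collisionFun_lt p (sq_nonneg s₀) hy0 hy
      rw [collisionFun_wavenumber hp (sq_nonneg s₀)] at h1
      filter_upwards [(hcont y).eventually_lt_const h1] with s hs
      by_contra! hle
      have h2 := collisionFun_wavenumber hp (sq_nonneg s)
      rcases hle.eq_or_lt with h3 | h3
      · rw [h3] at h2
        exact hs.ne h2
      · have h4 := collisionFun_lt p (sq_nonneg s) (wavenumber_nonneg hp (sq_nonneg s)) h3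
        linarith
  · have h1 := collisionFun_lt p (sq_nonneg s₀) hφ hy
    rw [collisionFun_wavenumber hp (sq_nonneg s₀)] at h1
    filter_upwards [(hcont y).eventually_const_lt h1] with s hs
    by_contra! hle
    have h2 := collisionFun_wavenumber hp (sq_nonneg s)
    rcases hle.eq_or_lt with h3 | h3
    · rw [← h3] at h2
      exact hs.ne' h2
    · have h4 := collisionFun_lt p (sq_nonneg s) (hφ.trans hy.le) h3
      linarith

/-- The wavenumber is an analytic function of `s = √h`, up to and including `s = 0`. -/
theorem analyticAt_wavenumber_sq {p : ℕ} (hp : 2 ≤ p) (s₀ : ℝ) :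
    AnalyticAt ℝ (fun s => wavenumber p (s ^ 2)) s₀ := by
  have hφ := wavenumber_nonneg hp (sq_nonneg s₀)
  set u : ℝ × ℝ := (s₀ ^ 2, wavenumber p (s₀ ^ 2)) with hu
  have hA := analyticAt_collisionFun p u
  have hC : ContDiffAt ℝ ⊤ (collisionFun p) u := hA.contDiffAt
  set L := fderiv ℝ (collisionFun p) u ∘L ContinuousLinearMap.inr ℝ ℝ ℝ with hL
  have hpos : 0 < L 1 := by
    have h1 : HasDerivAt (fun y : ℝ => collisionFun p (u.1, y)) (L 1) u.2 := by
      have h2 : HasFDerivAt (fun y : ℝ => (u.1, y)) (ContinuousLinearMap.inr ℝ ℝ ℝ) u.2 :=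
        hasFDerivAt_prodMk_right u.1 u.2
      exact (hA.differentiableAt.hasFDerivAt.comp u.2 h2).hasDerivAt
    have h3 := ((hasDerivAt_scaledOmega u.1 u.2).add
      ((hasDerivAt_scaledOmega u.1 (u.2 + p)).comp_add_const u.2 (p : ℝ))).sub_const
      (p * scaledOmega u.1 1)
    rw [h1.unique h3]
    exact add_pos (deriv_mul_rootTanh_pos (mul_nonneg (sq_nonneg s₀) hφ))
      (deriv_mul_rootTanh_pos (mul_nonneg (sq_nonneg s₀) (add_nonneg hφ p.cast_nonneg)))
  have hinv : L.IsInvertible := by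
    refine ⟨ContinuousLinearEquiv.unitsEquivAut ℝ (Units.mk0 (L 1) hpos.ne'), ?_⟩
    ext
    simp
  have htop : (⊤ : WithTop ℕ∞) ≠ 0 := by simp
  have h4 := hC.eventually_apply_eq_iff_implicitFunction htop hinv
  have h5 := (hC.contDiffAt_implicitFunction htop hinv).analyticAt
  have hsq : AnalyticAt ℝ (fun s : ℝ => s ^ 2) s₀ := analyticAt_id.pow 2
  have h6 : AnalyticAt ℝ (fun s : ℝ => hC.implicitFunction htop hinv (s ^ 2)) s₀ :=
    AnalyticAt.comp (g := hC.implicitFunction htop hinv) h5 hsq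
  refine h6.congr ?_
  have h7 : Tendsto (fun s => (s ^ 2, wavenumber p (s ^ 2))) (nhds s₀) (nhds u) :=
    hsq.continuousAt.tendsto.prodMk_nhds (tendsto_wavenumber_sq hp s₀)
  filter_upwards [h7.eventually h4] with s hs
  exact hs.1 (by rw [collisionFun_wavenumber hp (sq_nonneg s), hu,
    collisionFun_wavenumber hp (sq_nonneg s₀)])

end rescaled

end
end StokesIsola

/-! ### Finiteness of the set of zeros -/

namespace StokesIsola
noncomputable section

section meromorphic

/-- On `(0, ∞)`, `f` is a function of `s = √h` that is meromorphic on `[0, ∞)`, the endpoint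
included. -/
def IsRootMeromorphic (f : ℝ → ℝ) : Prop :=
  ∃ F : ℝ → ℝ, MeromorphicOn F (Set.Ici 0) ∧ ∀ s, 0 < s → F s = f (s ^ 2)

variable {f g : ℝ → ℝ}

theorem IsRootMeromorphic.const (a : ℝ) : IsRootMeromorphic (fun _ => a) :=
  ⟨fun _ => a, MeromorphicOn.const a, fun _ _ => rfl⟩

theorem IsRootMeromorphic.add (hf : IsRootMeromorphic f) (hg : IsRootMeromorphic g) :
    IsRootMeromorphic (fun h => f h + g h) := by
  obtain ⟨F, hF, hF'⟩ := hf
  obtain ⟨G, hG, hG'⟩ := hg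
  exact ⟨F + G, hF.add hG, fun s hs => by rw [Pi.add_apply, hF' s hs, hG' s hs]⟩

theorem IsRootMeromorphic.mul (hf : IsRootMeromorphic f) (hg : IsRootMeromorphic g) :
    IsRootMeromorphic (fun h => f h * g h) := by
  obtain ⟨F, hF, hF'⟩ := hf
  obtain ⟨G, hG, hG'⟩ := hg
  exact ⟨F * G, hF.mul hG, fun s hs => by rw [Pi.mul_apply, hF' s hs, hG' s hs]⟩

theorem IsRootMeromorphic.inv (hf : IsRootMeromorphic f) :
    IsRootMeromorphic (fun h => (f h)⁻¹) := by
  obtain ⟨F, hF, hF'⟩ := hf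
  exact ⟨F⁻¹, hF.inv, fun s hs => by rw [Pi.inv_apply, hF' s hs]⟩

theorem IsRootMeromorphic.neg (hf : IsRootMeromorphic f) : IsRootMeromorphic (fun h => -f h) := by
  simpa using (IsRootMeromorphic.const (-1)).mul hf

theorem IsRootMeromorphic.sub (hf : IsRootMeromorphic f) (hg : IsRootMeromorphic g) :
    IsRootMeromorphic (fun h => f h - g h) := by
  simpa [sub_eq_add_neg] using hf.add hg.neg

theorem IsRootMeromorphic.div (hf : IsRootMeromorphic f) (hg : IsRootMeromorphic g) :
    IsRootMeromorphic (fun h => f h / g h) := by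
  simpa [div_eq_mul_inv] using hf.mul hg.inv

theorem IsRootMeromorphic.pow (hf : IsRootMeromorphic f) (n : ℕ) :
    IsRootMeromorphic (fun h => f h ^ n) := by
  obtain ⟨F, hF, hF'⟩ := hf
  exact ⟨F ^ n, hF.pow n, fun s hs => by rw [Pi.pow_apply, hF' s hs]⟩

/-- A function that is nonzero for large `h` has finitely many zeros: if its zeros accumulated, it
would vanish identically by the identity principle. Meromorphy at `s = 0` excludes an accumulation
at the shallow-water limit. -/
theorem IsRootMeromorphic.finite_zeros (hf : IsRootMeromorphic f)
    (hne : ∀ᶠ h in atTop, f h ≠ 0) : {h : ℝ | 0 < h ∧ f h = 0}.Finite := by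
  obtain ⟨F, hF, hF'⟩ := hf
  obtain ⟨M, hM⟩ := eventually_atTop.1 hne
  set R := max M 1 with hR
  have hR1 : 1 ≤ R := le_max_right _ _
  have hR0 : 0 < R := one_pos.trans_le hR1
  have hbig : ∀ s, R ≤ s → F s ≠ 0 := fun s hs => by
    rw [hF' s (hR0.trans_le hs)]
    refine hM _ ?_
    have : M ≤ R := le_max_left _ _
    nlinarith
  have hmem : R + 1 ∈ Set.Ici (0 : ℝ) := by
    simp only [Set.mem_Ici]
    linarith
  have hord : meromorphicOrderAt F (R + 1) ≠ ⊤ := by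
    rw [meromorphicOrderAt_ne_top_iff_eventually_ne_zero (hF _ hmem)]
    refine Eventually.filter_mono nhdsWithin_le_nhds ?_
    filter_upwards [lt_mem_nhds (lt_add_one R)] with s hs
    exact hbig s hs.le
  have hall : ∀ s, 0 ≤ s → ∀ᶠ z in nhdsWithin s {s}ᶜ, F z ≠ 0 := fun s hs => by
    rw [← meromorphicOrderAt_ne_top_iff_eventually_ne_zero (hF s hs)]
    exact hF.meromorphicOrderAt_ne_top_of_isPreconnected isPreconnected_Ici hmem hs hord
  have hfin : {s ∈ Set.Icc 0 R | F s = 0}.Finite := by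
    by_contra hinf
    obtain ⟨s, hs, hacc⟩ := Set.Infinite.exists_accPt_of_subset_isCompact hinf
      (isCompact_Icc (a := 0) (b := R)) (Set.sep_subset _ _)
    rw [accPt_iff_frequently_nhdsNE] at hacc
    obtain ⟨z, hz, hz'⟩ := (hacc.and_eventually (hall s hs.1)).exists
    exact hz' hz.2
  refine (hfin.image (· ^ 2)).subset ?_
  rintro h ⟨hh, hzero⟩
  have hs := Real.sqrt_pos.2 hh
  have hsq : √h ^ 2 = h := Real.sq_sqrt hh.le
  have h0 : F √h = 0 := by rw [hF' _ hs, hsq, hzero]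
  refine ⟨√h, ⟨⟨hs.le, ?_⟩, h0⟩, hsq⟩
  by_contra! hlt
  exact hbig _ hlt.le h0

theorem isRootMeromorphic_of_analyticAt {F : ℝ → ℝ} (hF : ∀ s, AnalyticAt ℝ F s)
    (h : ∀ s, 0 < s → F s = f (s ^ 2)) : IsRootMeromorphic f :=
  ⟨F, fun s _ => (hF s).meromorphicAt, h⟩

theorem isRootMeromorphic_waveSpeed : IsRootMeromorphic waveSpeed := by
  refine isRootMeromorphic_of_analyticAt (F := fun s => s * scaledOmega (s ^ 2) 1)
    (fun s => analyticAt_id.mul (analyticAt_scaledOmega (analyticAt_id.pow 2) analyticAt_const))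
    fun s hs => ?_
  rw [waveSpeed_eq_Omega, Omega_eq_scaledOmega (sq_nonneg s) zero_le_one, Real.sqrt_sq hs.le]

theorem isRootMeromorphic_Om {p : ℕ} (hp : 2 ≤ p) (j : ℕ) : IsRootMeromorphic (Om p · j) := by
  refine isRootMeromorphic_of_analyticAt
    (F := fun s => s * scaledOmega (s ^ 2) (j + wavenumber p (s ^ 2)))
    (fun s => analyticAt_id.mul (analyticAt_scaledOmega (analyticAt_id.pow 2)
      (analyticAt_const.add (analyticAt_wavenumber_sq hp s)))) fun s hs => ?_
  have h1 := wavenumber_nonneg hp (sq_nonneg s)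
  rw [Om, Omega_eq_scaledOmega (sq_nonneg s) (by positivity), Real.sqrt_sq hs.le]

theorem isRootMeromorphic_tt {p : ℕ} (hp : 2 ≤ p) (j : ℕ) : IsRootMeromorphic (tt p · j) := by
  have hT : IsRootMeromorphic (tanhAt p · j) := by
    refine isRootMeromorphic_of_analyticAt
      (F := fun s => Real.tanh (s ^ 2 * (j + wavenumber p (s ^ 2)))) (fun s => ?_)
      fun s _ => rfl
    exact (analyticAt_tanh _).comp ((analyticAt_id.pow 2).mul
      (analyticAt_const.add (analyticAt_wavenumber_sq hp s)))
  obtain ⟨F, hF, hF'⟩ := (isRootMeromorphic_Om hp j).div hT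
  exact ⟨F, hF, fun s hs => (hF' s hs).trans (tt_eq hp (by positivity) j).symm⟩

theorem isRootMeromorphic_aCoeff (ℓ : ℕ) : IsRootMeromorphic (aCoeff ℓ) := by
  have hc := isRootMeromorphic_waveSpeed
  have hm := fun (a : ℝ) (n : ℕ) => (IsRootMeromorphic.const a).mul (hc.pow n)
  match ℓ with
  | 0 => exact .const 0
  | 1 => exact ((hc.pow 2).add (hc.pow 2).inv).neg
  | 2 => exact (((hm (-14) 4).add (hm 9 8)).sub (.const 3)).div (hm 4 8)
  | 3 =>
    exact (((((hc.pow 16).neg.sub (hm 98 12)).add (hm 252 8)).sub (hm 318 4)).sub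
      (.const 27)).div (hm 64 14)
  | 4 =>
    exact (((((((hm 9 24).add (hm 238 20)).sub (hm 233 16)).sub (hm 1676 12)).add
      (hm 743 8)).sub (hm 3042 4)).sub (.const 135)).div
      ((hm 128 20).mul ((hc.pow 4).add (.const 5)))
  | n + 5 => exact .const 0

theorem isRootMeromorphic_pCoeff (ℓ : ℕ) : IsRootMeromorphic (pCoeff ℓ) := by
  have hc := isRootMeromorphic_waveSpeed
  have hm := fun (a : ℝ) (n : ℕ) => (IsRootMeromorphic.const a).mul (hc.pow n)
  match ℓ with
  | 0 => exact .const 0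
  | 1 => exact (IsRootMeromorphic.const (-2)).mul hc.inv
  | 2 => exact (((IsRootMeromorphic.const 3).add (hc.pow 4)).div (hm 2 7)).neg
  | 3 =>
    exact (((((hc.pow 12).add (hm 17 8)).add (hm 51 4)).add (.const 27)).div
      (hm 32 13)).neg
  | 4 =>
    exact ((((((hc.pow 20).neg.sub (hm 39 16)).sub (hm 366 12)).sub (hm 850 8)).sub
      (hm 657 4)).sub (.const 135)).div ((hm 64 19).mul ((hc.pow 4).add (.const 5)))
  | n + 5 => exact .const 0

variable {p : ℕ}

theorem isRootMeromorphic_propagator (hp : 2 ≤ p) (j : ℕ) (σ : ℝ) :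
    IsRootMeromorphic (propagator p · j σ) :=
  (isRootMeromorphic_Om hp j).div ((IsRootMeromorphic.const 4).mul
    ((((IsRootMeromorphic.const (j : ℝ)).mul isRootMeromorphic_waveSpeed).sub
      ((IsRootMeromorphic.const σ).mul (isRootMeromorphic_Om hp j))).sub
      (isRootMeromorphic_Om hp 0)))

theorem isRootMeromorphic_pass (hp : 2 ≤ p) (j : ℕ) {A B : ℝ → ℝ} (hA : IsRootMeromorphic A)
    (hB : IsRootMeromorphic B) :
    IsRootMeromorphic (fun h => passU p h j (A h) (B h)) ∧
      IsRootMeromorphic (fun h => passW p h j (A h) (B h)) := by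
  have h1 := isRootMeromorphic_propagator hp j 1
  have h2 := isRootMeromorphic_propagator hp j (-1)
  have ht := isRootMeromorphic_tt hp j
  exact ⟨((h1.sub h2).mul hA).add (((h1.add h2).mul ht).mul hB),
    (((h1.add h2).mul ht).mul hA).add (((h1.sub h2).mul (ht.pow 2)).mul hB)⟩

theorem isRootMeromorphic_chain1 (hp : 2 ≤ p) :
    IsRootMeromorphic (chainU1 p) ∧ IsRootMeromorphic (chainW1 p) :=
  isRootMeromorphic_pass hp 1
    ((isRootMeromorphic_aCoeff 1).add ((isRootMeromorphic_pCoeff 1).mul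
      (isRootMeromorphic_tt hp 0))) (isRootMeromorphic_pCoeff 1).neg

theorem isRootMeromorphic_chainAB2 (hp : 2 ≤ p) :
    IsRootMeromorphic (chainA2 p) ∧ IsRootMeromorphic (chainB2 p) := by
  obtain ⟨hU1, hW1⟩ := isRootMeromorphic_chain1 hp
  have ha := isRootMeromorphic_aCoeff
  have hq := isRootMeromorphic_pCoeff
  have ht := isRootMeromorphic_tt hp 0
  exact ⟨((ha 2).add ((hq 2).mul ht)).add ((hU1.mul (ha 1)).sub (hW1.mul (hq 1))),
    (hq 2).neg.sub (hU1.mul (hq 1))⟩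

theorem isRootMeromorphic_chainAB3 (hp : 2 ≤ p) :
    IsRootMeromorphic (chainA3 p) ∧ IsRootMeromorphic (chainB3 p) := by
  obtain ⟨hU1, hW1⟩ := isRootMeromorphic_chain1 hp
  obtain ⟨hA2, hB2⟩ := isRootMeromorphic_chainAB2 hp
  obtain ⟨hU2, hW2⟩ := isRootMeromorphic_pass hp 2 hA2 hB2
  have ha := isRootMeromorphic_aCoeff
  have hq := isRootMeromorphic_pCoeff
  have ht := isRootMeromorphic_tt hp 0
  exact ⟨(((ha 3).add ((hq 3).mul ht)).add ((hU1.mul (ha 2)).sub (hW1.mul (hq 2)))).add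
      ((hU2.mul (ha 1)).sub (hW2.mul (hq 1))),
    ((hq 3).neg.sub (hU1.mul (hq 2))).sub (hU2.mul (hq 1))⟩

theorem isRootMeromorphic_chainAB4 (hp : 2 ≤ p) :
    IsRootMeromorphic (chainA4 p) ∧ IsRootMeromorphic (chainB4 p) := by
  obtain ⟨hU1, hW1⟩ := isRootMeromorphic_chain1 hp
  obtain ⟨hA2, hB2⟩ := isRootMeromorphic_chainAB2 hp
  obtain ⟨hU2, hW2⟩ := isRootMeromorphic_pass hp 2 hA2 hB2
  obtain ⟨hA3, hB3⟩ := isRootMeromorphic_chainAB3 hp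
  obtain ⟨hU3, hW3⟩ := isRootMeromorphic_pass hp 3 hA3 hB3
  have ha := isRootMeromorphic_aCoeff
  have hq := isRootMeromorphic_pCoeff
  have ht := isRootMeromorphic_tt hp 0
  exact ⟨((((ha 4).add ((hq 4).mul ht)).add ((hU1.mul (ha 3)).sub (hW1.mul (hq 3)))).add
      ((hU2.mul (ha 2)).sub (hW2.mul (hq 2)))).add ((hU3.mul (ha 1)).sub (hW3.mul (hq 1))),
    (((hq 4).neg.sub (hU1.mul (hq 3))).sub (hU2.mul (hq 2))).sub (hU3.mul (hq 1))⟩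

/-- The amplitude, a square root that need not be meromorphic, is positive and does not affect the
zeros. -/
theorem finite_zeros_of_amplitude_mul (hp : 2 ≤ p) {A B β : ℝ → ℝ}
    (hAB : IsRootMeromorphic A ∧ IsRootMeromorphic B)
    (hβ : ∀ h, β h = amplitude p h * (A h + B h * tt p h p)) (hne : ∀ᶠ h in atTop, β h ≠ 0) :
    {h : ℝ | 0 < h ∧ β h = 0}.Finite := by
  have hS := hAB.1.add (hAB.2.mul (isRootMeromorphic_tt hp p))
  refine (hS.finite_zeros ?_).subset ?_
  · filter_upwards [hne] with h hh
    rw [hβ] at hh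
    exact right_ne_zero_of_mul hh
  · rintro h ⟨hh, hzero⟩
    refine ⟨hh, ?_⟩
    have hamp : 0 < amplitude p h := by
      have h0 := Om_pos hp hh 0
      have h1 := Om_pos hp hh p
      unfold amplitude
      positivity
    rw [hβ] at hzero
    exact (mul_eq_zero.1 hzero).resolve_left hamp.ne'

end meromorphic

theorem eventually_ne_zero_of_asymptotic {f u v : ℝ → ℝ} {a : ℝ} (ha : a ≠ 0)
    (hf : (fun h => f h - a * Real.exp (u h)) =O[atTop] (fun h => Real.exp (v h)))
    (huv : Tendsto (fun h => u h - v h) atTop atTop) : ∀ᶠ h in atTop, f h ≠ 0 := by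
  have h1 := hf.trans_isLittleO (Real.isLittleO_exp_comp_exp_comp.2 huv)
  filter_upwards [h1.bound (half_pos (abs_pos.2 ha))] with h hh hzero
  rw [hzero, zero_sub, norm_neg, norm_mul, Real.norm_eq_abs] at hh
  have h2 : 0 < ‖Real.exp (u h)‖ := by simp [Real.exp_pos]
  have h3 := abs_pos.2 ha
  nlinarith

theorem eventually_betaTwo_ne_zero : ∀ᶠ h in atTop, betaTwo h ≠ 0 := by
  refine eventually_ne_zero_of_asymptotic (by positivity) betaTwo_asymptotic ?_
  refine (tendsto_id.const_mul_atTop (show (0 : ℝ) < 1 / 4 by norm_num)).congr fun h => ?_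
  simp only [id]
  ring

theorem eventually_betaThree_ne_zero : ∀ᶠ h in atTop, betaThree h ≠ 0 := by
  refine eventually_ne_zero_of_asymptotic (by positivity) betaThree_asymptotic ?_
  refine tendsto_id.congr fun h => ?_
  simp only [id]
  ring

theorem eventually_betaFour_ne_zero : ∀ᶠ h in atTop, betaFour h ≠ 0 := by
  refine eventually_ne_zero_of_asymptotic (neg_ne_zero.2 (by positivity)) betaFour_asymptotic ?_
  refine (tendsto_id.const_mul_atTop (show (0 : ℝ) < 2 by norm_num)).congr fun h => ?_
  simp only [id]
  ring

end
end StokesIsola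

theorem theorem2 :
    (fun h : ℝ => StokesIsola.betaTwo h - 3 * √3 / 64 * Real.exp (-h / 2))
        =O[atTop] (fun h : ℝ => Real.exp (-(3 * h) / 4)) ∧
    (fun h : ℝ => StokesIsola.betaThree h - 2 * √2 / 3 * Real.exp (-2 * h))
        =O[atTop] (fun h : ℝ => Real.exp (-3 * h)) ∧
    (fun h : ℝ => StokesIsola.betaFour h - (-(5 * √5 / (8 * √3))) * Real.exp (-2 * h))
        =O[atTop] (fun h : ℝ => Real.exp (-4 * h)) ∧
    (∃ h : ℝ, 0 < h ∧ StokesIsola.betaTwo h ≠ 0) ∧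
    (∃ h : ℝ, 0 < h ∧ StokesIsola.betaThree h ≠ 0) ∧
    (∃ h : ℝ, 0 < h ∧ StokesIsola.betaFour h ≠ 0) ∧
    {h : ℝ | 0 < h ∧ StokesIsola.betaTwo h = 0}.Finite ∧
    {h : ℝ | 0 < h ∧ StokesIsola.betaThree h = 0}.Finite ∧
    {h : ℝ | 0 < h ∧ StokesIsola.betaFour h = 0}.Finite := by
  refine ⟨StokesIsola.betaTwo_asymptotic, StokesIsola.betaThree_asymptotic,
    StokesIsola.betaFour_asymptotic,
    ((eventually_gt_atTop 0).and StokesIsola.eventually_betaTwo_ne_zero).exists,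
    ((eventually_gt_atTop 0).and StokesIsola.eventually_betaThree_ne_zero).exists,
    ((eventually_gt_atTop 0).and StokesIsola.eventually_betaFour_ne_zero).exists, ?_, ?_, ?_⟩
  · exact StokesIsola.finite_zeros_of_amplitude_mul le_rfl
      (StokesIsola.isRootMeromorphic_chainAB2 le_rfl) StokesIsola.betaTwo_eq
      StokesIsola.eventually_betaTwo_ne_zero
  · exact StokesIsola.finite_zeros_of_amplitude_mul (by norm_num)
      (StokesIsola.isRootMeromorphic_chainAB3 (by norm_num)) StokesIsola.betaThree_eq
      StokesIsola.eventually_betaThree_ne_zero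
  · exact StokesIsola.finite_zeros_of_amplitude_mul (by norm_num)
      (StokesIsola.isRootMeromorphic_chainAB4 (by norm_num)) StokesIsola.betaFour_eq
      StokesIsola.eventually_betaFour_ne_zero
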